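/- **Conventions.** A *metric group* is a group $G$ with a complete bi-invariant metric $d\le 1$. For a complex Hilbert space $\mathbf H$ let $B_n$ be the closed ball of radius $n$ around $0$, $n\in\mathbb N$. Let $\mathcal F=\{F_n\}_{n\in\mathbb N}$ be a family of continuity moduli, i.e. functions with $F_n(\varepsilon)>0$ for all $\varepsilon>0$. A unitary representation of $G$ on $\mathbf H$ is a *unitary $\mathcal F$-representation* if for all $n$, $\varepsilon>0$, $v\in B_n$ and $g,g'\in G$ with $d(g,g')<F_n(\varepsilon)$ one has $\|gv-g'v\|<\varepsilon$. For $Q\subseteq G$ a vector $v$ is a *$(Q,\varepsilon)$-almost invariant unit vector* if $\|v\|=1$ and $\sup_{x\in Q}\|xv-v\|<\varepsilon$. The representation *almost contains the unit representation* $1_G$ if it has a $(Q,\varepsilon)$-almost invariant unit vector for every compact $Q\subseteq G$ and every $\varepsilon>0$. A unitary $\mathcal F$-representation gives the many-sorted metric structure $A(G,\mathbf H)$ of continuous logic with the sorts $G$ and $B_n$, the group operations, the vectors $0$, the inclusions $B_m\to B_n$, the maps $\lambda_c:B_m\to B_{km}$ ($c\in\mathbb C$, $k\ge1$, $k-1\le|c|<k$),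 the maps $+,-:B_n\times B_n\to B_{2n}$, the real and imaginary parts of the inner product, and the action $G\times B_n\to B_n$, whose modulus in the $G$-variable is $F_n$. Let $\mathcal K_{GH}(\mathcal F)$ be the class of structures in this signature which is axiomatized by the axioms of groups with bi-invariant metrics, of (the balls of) complex Hilbert spaces, and of linear unitary actions. For $\delta\in(0,1)\cap\mathbb Q$ let $\mathcal K_\delta(\mathcal F)$ be the subclass axiomatized by all the axioms $$\sup_{x_1,\dots,x_k\in G}\ \inf_{v\in B_m}\ \sup_{x\in G}\ \min\Bigl(\max_{1\le i\le k}\bigl(\delta\mathbin{\dot-}d(x,x_i)\bigr),\ \max\bigl(\|xv-v\|\mathbin{\dot-}\tfrac1n,\ |1-\|v\||\bigr)\Bigr)=0,\qquad k,m,n\ge 1,$$ where $a\mathbin{\dot-}b=\max(a-b,0)$. **Theorem.** Let $\mathcal F$ be a family of continuity moduli. (a) Let $G$ be a locally compact metric group with a unitary $\mathcal F$-representation on a complex Hilbert space $\mathbf H$. The representation almost contains $1_G$ if and only if $A(G,\mathbf H)\in\bigcup\{\mathcal K_\delta(\mathcal F):\delta\in(0,1)\cap\mathbb Q\}$. (b)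 Let $G$ be a locally compact metric group. Suppose that for every compact $Q\subseteq G$ and every $\varepsilon>0$ there is a unitary $\mathcal F$-representation of $G$ with a $(Q,\varepsilon)$-almost invariant unit vector but without non-zero invariant vectors. Then $G$ has a unitary $\mathcal F$-representation, on an infinite-dimensional complex Hilbert space $\mathbf H$, with $A(G,\mathbf H)\in\mathcal K_{GH}(\mathcal F)$, which almost contains $1_G$ but does not fix any vector of norm $1$. Moreover, every elementary substructure of $A(G,\mathbf H)$ is of the form $A(G_0,\mathbf H_0)$ where $G_0\le G$ is a subgroup and $\mathbf H_0\subseteq\mathbf H$ a $G_0$-invariant subspace, both complete (hence closed), with $G_0\preceq G$ as metric groups and $\mathbf H_0\preceq\mathbf H$ as Hilbert spaces, and with the restricted action it is a unitary $\mathcal F$-representation of $G_0$ which almost contains $1_{G_0}$ but does not fix any vector of norm $1$. -/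

import Mathlib

universe u

noncomputable section

/-! Many-sorted continuous logic. -/

/-- A many-sorted signature of continuous logic. Function and predicate symbols are indexed by
the list of sorts of their arguments; every symbol carries a continuity modulus for each of its
arguments, every predicate symbol an interval of values, and every sort a bound on its diameter. -/
structure ContSig where
  Srt : Type
  Fn : List Srt → Srt → Type
  Rel : List Srt → Type
  fnMod : ∀ {l : List Srt} {s : Srt}, Fn l s → Fin l.length → ℝ → ℝ
  relMod : ∀ {l : List Srt}, Rel l → Fin l.length → ℝ → ℝ
  relLo : ∀ {l : List Srt}, Rel l → ℝ
  relHi : ∀ {l : List Srt}, Rel l → ℝ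
  diam : Srt → ℝ

/-- Tuples of elements of the sorts in `l`. -/
abbrev Args {S : Type} (X : S → Type u) (l : List S) : Type u := ∀ i : Fin l.length, X (l.get i)

def Args.zero {S : Type} {X : S → Type u} : Args X [] := fun i => i.elim0

def Args.one {S : Type} {X : S → Type u} {s : S} (x : X s) : Args X [s]
  | ⟨0, _⟩ => x

def Args.two {S : Type} {X : S → Type u} {s t : S} (a : X s) (b : X t) : Args X [s, t]
  | ⟨0, _⟩ => a
  | ⟨1, _⟩ => b

/-- The first and the second entry of a tuple. -/
def Args.fst {S : Type} {X : S → Type u} {s : S} {l : List S} (a : Args X (s :: l)) : X s :=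
  a ⟨0, Nat.succ_pos _⟩

def Args.snd {S : Type} {X : S → Type u} {s t : S} {l : List S} (a : Args X (s :: t :: l)) : X t :=
  a ⟨1, Nat.succ_lt_succ (Nat.succ_pos _)⟩

theorem Args.agree_two {S : Type} {X : S → Type u} {s t : S} {a b : Args X [s, t]}
    {i : Fin [s, t].length} (hab : ∀ j, j ≠ i → a j = b j) :
    (i = ⟨0, Nat.succ_pos _⟩ ∧ a.snd = b.snd) ∨
      (i = ⟨1, Nat.succ_lt_succ (Nat.succ_pos _)⟩ ∧ a.fst = b.fst) := by
  obtain ⟨i, hi⟩ := i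
  match i, hi with
  | 0, _ => exact Or.inl ⟨rfl, hab _ (by simp)⟩
  | 1, _ => exact Or.inr ⟨rfl, hab _ (by simp)⟩

theorem Args.index_one {S : Type} {s : S} (i : Fin [s].length) : i = ⟨0, Nat.succ_pos _⟩ := by
  obtain ⟨i, hi⟩ := i
  match i, hi with
  | 0, _ => rfl

/-- A metric structure: complete bounded metric sorts, with operations and predicates which obey
the moduli of the signature in each argument separately. -/
structure MetricStr (L : ContSig) where
  car : L.Srt → Type u
  met : ∀ s, MetricSpace (car s)
  complete : ∀ s, CompleteSpace (car s)
  nonempty : ∀ s, Nonempty (car s)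
  dist_le : ∀ s (x y : car s), dist x y ≤ L.diam s
  fn : ∀ {l : List L.Srt} {s : L.Srt}, L.Fn l s → Args car l → car s
  rel : ∀ {l : List L.Srt}, L.Rel l → Args car l → ℝ
  fn_mod : ∀ {l : List L.Srt} {s : L.Srt} (f : L.Fn l s) (i : Fin l.length) (ε : ℝ), 0 < ε →
    ∀ (a b : Args car l), (∀ j, j ≠ i → a j = b j) →
      dist (a i) (b i) < L.fnMod f i ε → dist (fn f a) (fn f b) < ε
  rel_mod : ∀ {l : List L.Srt} (R : L.Rel l) (i : Fin l.length) (ε : ℝ), 0 < ε →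
    ∀ a b : Args car l, (∀ j, j ≠ i → a j = b j) →
      dist (a i) (b i) < L.relMod R i ε → |rel R a - rel R b| < ε
  rel_mem : ∀ {l : List L.Srt} (R : L.Rel l) (a : Args car l),
    rel R a ∈ Set.Icc (L.relLo R) (L.relHi R)

attribute [instance] MetricStr.met MetricStr.complete MetricStr.nonempty

/-- Terms; `var s n` is the `n`-th variable of sort `s`. -/
inductive CTerm (L : ContSig) : L.Srt → Type
  | var (s : L.Srt) (n : ℕ) : CTerm L s
  | app {l : List L.Srt} {s : L.Srt} (f : L.Fn l s)
      (a : ∀ i : Fin l.length, CTerm L (l.get i)) : CTerm L s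

/-- Formulas of continuous logic: atomic formulas, continuous connectives, `sup` and `inf`. -/
inductive CFormula (L : ContSig) : Type
  | dist {s : L.Srt} (t t' : CTerm L s) : CFormula L
  | rel {l : List L.Srt} (R : L.Rel l) (a : ∀ i : Fin l.length, CTerm L (l.get i)) : CFormula L
  | conn {k : ℕ} (c : C(Fin k → ℝ, ℝ)) (φ : Fin k → CFormula L) : CFormula L
  | sup (s : L.Srt) (n : ℕ) (φ : CFormula L) : CFormula L
  | inf (s : L.Srt) (n : ℕ) (φ : CFormula L) : CFormula L

namespace MetricStr

variable {L : ContSig}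

/-- Assignments of elements of a structure to the variables. -/
abbrev Asg (M : MetricStr.{u} L) : Type u := ∀ s : L.Srt, ℕ → M.car s

open Classical in
/-- Change the value of the `n`-th variable of sort `s` to `a`. -/
def upd (M : MetricStr.{u} L) (ρ : M.Asg) (s : L.Srt) (n : ℕ) (a : M.car s) : M.Asg :=
  Function.update ρ s (Function.update (ρ s) n a)

/-- The value of a term. -/
def tval (M : MetricStr.{u} L) (ρ : M.Asg) : ∀ {s : L.Srt}, CTerm L s → M.car s
  | _, .var s n => ρ s n
  | _, .app f a => M.fn f (fun i => M.tval ρ (a i))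

/-- The value of a formula. -/
def val (M : MetricStr.{u} L) : CFormula L → M.Asg → ℝ
  | .dist t t', ρ => Dist.dist (M.tval ρ t) (M.tval ρ t')
  | .rel R a, ρ => M.rel R (fun i => M.tval ρ (a i))
  | .conn c φ, ρ => c (fun i => M.val (φ i) ρ)
  | .sup s n φ, ρ => ⨆ a : M.car s, M.val φ (M.upd ρ s n a)
  | .inf s n φ, ρ => ⨅ a : M.car s, M.val φ (M.upd ρ s n a)

/-- `M` is a model of the conditions `φ = 0`, `φ ∈ T`. -/
def Models (M : MetricStr.{u} L) (T : Set (CFormula L)) : Prop :=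
  ∀ φ ∈ T, ∀ ρ : M.Asg, M.val φ ρ = 0

/-- Substructures: closed non-empty subsets of the sorts which are stable under the operations. -/
structure Sub (M : MetricStr.{u} L) where
  car : ∀ s : L.Srt, Set (M.car s)
  closed : ∀ s, IsClosed (car s)
  nonempty : ∀ s, (car s).Nonempty
  fn_mem : ∀ {l : List L.Srt} {s : L.Srt} (f : L.Fn l s) (a : Args M.car l),
    (∀ i, a i ∈ car (l.get i)) → M.fn f a ∈ car s

/-- The structure induced on a substructure. -/
def Sub.toStr {M : MetricStr.{u} L} (N : M.Sub) : MetricStr.{u} L where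
  car s := N.car s
  met _ := inferInstance
  complete s := (N.closed s).completeSpace_coe
  nonempty s := (N.nonempty s).to_subtype
  dist_le s x y := M.dist_le s x y
  fn f a := ⟨M.fn f (fun i => (a i).1), N.fn_mem f _ (fun i => (a i).2)⟩
  rel R a := M.rel R (fun i => (a i).1)
  fn_mod f i ε hε a b hab h :=
    M.fn_mod f i ε hε _ _ (fun j hj => congrArg Subtype.val (hab j hj)) h
  rel_mod R i ε hε a b hab h :=
    M.rel_mod R i ε hε _ _ (fun j hj => congrArg Subtype.val (hab j hj)) h
  rel_mem R a := M.rel_mem R _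

/-- `N` is an elementary substructure of `M`. -/
def Sub.IsElementary {M : MetricStr.{u} L} (N : M.Sub) : Prop :=
  ∀ (φ : CFormula L) (ρ : N.toStr.Asg), N.toStr.val φ ρ = M.val φ (fun s n => (ρ s n).1)

/-- Isomorphisms of metric structures. -/
structure Iso (M N : MetricStr.{u} L) where
  map : ∀ s : L.Srt, M.car s ≃ N.car s
  map_dist : ∀ s (x y : M.car s), Dist.dist (map s x) (map s y) = Dist.dist x y
  map_fn : ∀ {l : List L.Srt} {s : L.Srt} (f : L.Fn l s) (a : Args M.car l),
    map s (M.fn f a) = N.fn f (fun i => map _ (a i))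
  map_rel : ∀ {l : List L.Srt} (R : L.Rel l) (a : Args M.car l),
    M.rel R a = N.rel R (fun i => map _ (a i))

end MetricStr

namespace CFormula

variable {L : ContSig}

/-! Some connectives. -/

def const (r : ℝ) : CFormula L := .conn (k := 0) ⟨fun _ => r, by fun_prop⟩ (fun i => i.elim0)
def smul (r : ℝ) (φ : CFormula L) : CFormula L :=
  .conn (k := 1) ⟨fun x => r * x 0, by fun_prop⟩ ![φ]
def sq (φ : CFormula L) : CFormula L := .conn (k := 1) ⟨fun x => x 0 ^ 2, by fun_prop⟩ ![φ]
def plus (φ ψ : CFormula L) : CFormula L :=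
  .conn (k := 2) ⟨fun x => x 0 + x 1, by fun_prop⟩ ![φ, ψ]
/-- The connective `|x - y|`. -/
def absDiff (φ ψ : CFormula L) : CFormula L :=
  .conn (k := 2) ⟨fun x => |x 0 - x 1|, by fun_prop⟩ ![φ, ψ]
/-- The connective `max (x - y) 0`. -/
def tsub (φ ψ : CFormula L) : CFormula L :=
  .conn (k := 2) ⟨fun x => max (x 0 - x 1) 0, by fun_prop⟩ ![φ, ψ]
def fmin (φ ψ : CFormula L) : CFormula L :=
  .conn (k := 2) ⟨fun x => min (x 0) (x 1), by fun_prop⟩ ![φ, ψ]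
def fmax (φ ψ : CFormula L) : CFormula L :=
  .conn (k := 2) ⟨fun x => max (x 0) (x 1), by fun_prop⟩ ![φ, ψ]

/-- `max (φ 0) … (φ k)`. -/
def fmaxUpTo (φ : ℕ → CFormula L) : ℕ → CFormula L
  | 0 => φ 0
  | k + 1 => fmax (fmaxUpTo φ k) (φ (k + 1))

/-- `sup` over the variables `0, …, k - 1` of sort `s`. -/
def supUpTo (s : L.Srt) : ℕ → CFormula L → CFormula L
  | 0, φ => φ
  | k + 1, φ => supUpTo s k (.sup s k φ)

end CFormula

/-! The signatures of metric groups, of complex Hilbert spaces, and of the two together with an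
action. -/

/-- The integer `k ≥ 1` with `k - 1 ≤ |c| < k`. -/
def scal (c : ℂ) : ℕ := ⌊‖c‖⌋₊ + 1

/-- The continuity modulus `ε / |c|` of scalar multiplication by `c` (any modulus if `c = 0`). -/
def scalMod (c : ℂ) (ε : ℝ) : ℝ := if c = 0 then ε else ε / ‖c‖

inductive GrpFn : List Unit → Unit → Type
  | mul : GrpFn [(), ()] ()
  | inv : GrpFn [()] ()
  | one : GrpFn [] ()

/-- The signature `(d, ·, ⁻¹, 1)` of metric groups. -/
abbrev LGrp : ContSig where
  Srt := Unit
  Fn := GrpFn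
  Rel _ := Empty
  fnMod _ _ ε := ε
  relMod R := R.elim
  relLo R := R.elim
  relHi R := R.elim
  diam _ := 1

/-- The operations of complex Hilbert spaces; sort `n` is the ball of radius `n`. -/
inductive HilbFn : List ℕ → ℕ → Type
  | zero (n : ℕ) : HilbFn [] n
  | incl (m n : ℕ) (h : m ≤ n) : HilbFn [m] n
  | scale (c : ℂ) (m : ℕ) : HilbFn [m] (scal c * m)
  | add (n : ℕ) : HilbFn [n, n] (2 * n)
  | sub (n : ℕ) : HilbFn [n, n] (2 * n)

inductive HilbRel : List ℕ → Type
  | re (n : ℕ) : HilbRel [n, n]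
  | im (n : ℕ) : HilbRel [n, n]

/-- The signature of complex Hilbert spaces. -/
abbrev LHilb : ContSig where
  Srt := ℕ
  Fn := HilbFn
  Rel := HilbRel
  fnMod f _ ε := match f with
    | .scale c _ => scalMod c ε
    | _ => ε
  relMod R _ ε := match R with
    | .re n => ε / max (n : ℝ) 1
    | .im n => ε / max (n : ℝ) 1
  relLo R := match R with
    | .re n => -(n : ℝ) ^ 2
    | .im n => -(n : ℝ) ^ 2
  relHi R := match R with
    | .re n => (n : ℝ) ^ 2
    | .im n => (n : ℝ) ^ 2
  diam n := 2 * n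

inductive GHSort : Type
  | grp : GHSort
  | ball (n : ℕ) : GHSort

open GHSort in
inductive GHFn : List GHSort → GHSort → Type
  | mul : GHFn [grp, grp] grp
  | inv : GHFn [grp] grp
  | one : GHFn [] grp
  | zero (n : ℕ) : GHFn [] (ball n)
  | incl (m n : ℕ) (h : m ≤ n) : GHFn [ball m] (ball n)
  | scale (c : ℂ) (m : ℕ) : GHFn [ball m] (ball (scal c * m))
  | add (n : ℕ) : GHFn [ball n, ball n] (ball (2 * n))
  | sub (n : ℕ) : GHFn [ball n, ball n] (ball (2 * n))
  | act (n : ℕ) : GHFn [grp, ball n] (ball n)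

open GHSort in
inductive GHRel : List GHSort → Type
  | re (n : ℕ) : GHRel [ball n, ball n]
  | im (n : ℕ) : GHRel [ball n, ball n]

/-- The signature of metric groups acting on Hilbert spaces, where `F n` is the continuity modulus
of the group variable of the operation `G × Bₙ → Bₙ`. -/
abbrev LGH (F : ℕ → ℝ → ℝ) : ContSig where
  Srt := GHSort
  Fn := GHFn
  Rel := GHRel
  fnMod f i ε := match f with
    | .scale c _ => scalMod c ε
    | .act n => if i.val = 0 then F n ε else ε
    | _ => ε
  relMod R _ ε := match R with
    | .re n => ε / max (n : ℝ) 1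
    | .im n => ε / max (n : ℝ) 1
  relLo R := match R with
    | .re n => -(n : ℝ) ^ 2
    | .im n => -(n : ℝ) ^ 2
  relHi R := match R with
    | .re n => (n : ℝ) ^ 2
    | .im n => (n : ℝ) ^ 2
  diam s := match s with
    | .grp => 1
    | .ball n => 2 * n

/-! Metric groups, Hilbert spaces and unitary representations as metric structures. -/

/-- `G` is a continuous structure: its metric is complete, bi-invariant and bounded by `1`. -/
structure IsMetricGroup (G : Type u) [Group G] [MetricSpace G] : Prop where
  complete : CompleteSpace G
  dist_le_one : ∀ x y : G, dist x y ≤ 1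
  left_inv : ∀ g x y : G, dist (g * x) (g * y) = dist x y
  right_inv : ∀ g x y : G, dist (x * g) (y * g) = dist x y

theorem IsMetricGroup.dist_inv {G : Type u} [Group G] [MetricSpace G] (hG : IsMetricGroup G)
    (x y : G) : dist x⁻¹ y⁻¹ = dist x y := by
  rw [← hG.left_inv x, ← hG.right_inv y]
  simp [dist_comm]

theorem IsMetricGroup.mul_mod_left {G : Type u} [Group G] [MetricSpace G] (hG : IsMetricGroup G)
    {x x' y y' : G} {ε : ℝ} (h : y = y') (h' : dist x x' < ε) : dist (x * y) (x' * y') < ε := by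
  rwa [h, hG.right_inv]

theorem IsMetricGroup.mul_mod_right {G : Type u} [Group G] [MetricSpace G] (hG : IsMetricGroup G)
    {x x' y y' : G} {ε : ℝ} (h : x = x') (h' : dist y y' < ε) : dist (x * y) (x' * y') < ε := by
  rwa [h, hG.left_inv]

/-- The metric group `G` as a metric structure. -/
def grpStr (G : Type u) [Group G] [MetricSpace G] (hG : IsMetricGroup G) :
    MetricStr.{u} LGrp where
  car _ := G
  met _ := inferInstance
  complete _ := hG.complete
  nonempty _ := ⟨1⟩
  dist_le _ x y := hG.dist_le_one x y
  fn f a := match f with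
    | .mul => a.fst * a.snd
    | .inv => a.fst⁻¹
    | .one => 1
  rel R := R.elim
  fn_mod := by
    rintro l s (_ | _ | _) i ε hε a b hab h
    · obtain ⟨rfl, h1⟩ | ⟨rfl, h1⟩ := Args.agree_two hab
      · exact hG.mul_mod_left h1 h
      · exact hG.mul_mod_right h1 h
    · obtain rfl := Args.index_one i
      exact (hG.dist_inv _ _).trans_lt h
    · exact i.elim0
  rel_mod R := R.elim
  rel_mem R := R.elim

/-- The ball of radius `n` around `0`. -/
abbrev HBall (H : Type u) [NormedAddCommGroup H] (n : ℕ) : Type u := {x : H // ‖x‖ ≤ n}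

namespace HBall

variable {H : Type u} [NormedAddCommGroup H]

theorem dist_le {n : ℕ} (x y : HBall H n) : dist x y ≤ 2 * n := by
  have := dist_triangle_right x.1 y.1 0
  simp only [dist_zero_right] at this
  rw [Subtype.dist_eq]
  linarith [x.2, y.2]

theorem completeSpace [CompleteSpace H] (n : ℕ) : CompleteSpace (HBall H n) :=
  (isClosed_le continuous_norm continuous_const).completeSpace_coe

def zero (n : ℕ) : HBall H n := ⟨0, by simp⟩

def incl {m n : ℕ} (h : m ≤ n) (x : HBall H m) : HBall H n :=
  ⟨x.1, x.2.trans (by exact_mod_cast h)⟩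

def add {n : ℕ} (x y : HBall H n) : HBall H (2 * n) :=
  ⟨x.1 + y.1, by push_cast; linarith [norm_add_le x.1 y.1, x.2, y.2]⟩

def sub {n : ℕ} (x y : HBall H n) : HBall H (2 * n) :=
  ⟨x.1 - y.1, by push_cast; linarith [norm_sub_le x.1 y.1, x.2, y.2]⟩

theorem add_mod_left {n : ℕ} {x x' y y' : HBall H n} {ε : ℝ} (h : y = y') (h' : dist x x' < ε) :
    dist (add x y) (add x' y') < ε := by
  subst h
  simpa [add, Subtype.dist_eq] using h'

theorem add_mod_right {n : ℕ} {x x' y y' : HBall H n} {ε : ℝ} (h : x = x') (h' : dist y y' < ε) :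
    dist (add x y) (add x' y') < ε := by
  subst h
  simpa [add, Subtype.dist_eq] using h'

theorem sub_mod_left {n : ℕ} {x x' y y' : HBall H n} {ε : ℝ} (h : y = y') (h' : dist x x' < ε) :
    dist (sub x y) (sub x' y') < ε := by
  subst h
  simpa only [sub, Subtype.dist_eq, dist_sub_right] using h'

theorem sub_mod_right {n : ℕ} {x x' y y' : HBall H n} {ε : ℝ} (h : x = x') (h' : dist y y' < ε) :
    dist (sub x y) (sub x' y') < ε := by
  subst h
  simpa only [sub, Subtype.dist_eq, dist_sub_left] using h'

variable [InnerProductSpace ℂ H]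

def scale (c : ℂ) {m : ℕ} (x : HBall H m) : HBall H (scal c * m) :=
  ⟨c • x.1, by
    rw [norm_smul, scal]
    push_cast
    exact mul_le_mul (Nat.lt_floor_add_one _).le x.2 (norm_nonneg _) (by positivity)⟩

theorem scale_dist (c : ℂ) {m : ℕ} (x y : HBall H m) {ε : ℝ} (hε : 0 < ε)
    (h : dist x y < scalMod c ε) : dist (scale c x) (scale c y) < ε := by
  rw [Subtype.dist_eq]
  simp only [scale, dist_smul₀]
  unfold scalMod at h
  split_ifs at h with hc
  · simpa [hc] using hε
  · rw [lt_div_iff₀ (by simpa using hc), mul_comm] at h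
    exact h

def re {n : ℕ} (x y : HBall H n) : ℝ := (inner ℂ x.1 y.1).re
def im {n : ℕ} (x y : HBall H n) : ℝ := (inner ℂ x.1 y.1).im

theorem norm_inner_le {n : ℕ} (x y : HBall H n) : ‖inner ℂ x.1 y.1‖ ≤ (n : ℝ) ^ 2 := by
  refine (_root_.norm_inner_le_norm x.1 y.1).trans ?_
  rw [pow_two]
  exact mul_le_mul x.2 y.2 (norm_nonneg _) (by positivity)

theorem re_mem {n : ℕ} (x y : HBall H n) : re x y ∈ Set.Icc (-(n : ℝ) ^ 2) ((n : ℝ) ^ 2) :=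
  abs_le.1 ((Complex.abs_re_le_norm _).trans (norm_inner_le x y))

theorem im_mem {n : ℕ} (x y : HBall H n) : im x y ∈ Set.Icc (-(n : ℝ) ^ 2) ((n : ℝ) ^ 2) :=
  abs_le.1 ((Complex.abs_im_le_norm _).trans (norm_inner_le x y))

theorem inner_mod_left {n : ℕ} (x y z : HBall H n) {ε : ℝ}
    (h : dist x y < ε / max (n : ℝ) 1) : ‖inner ℂ x.1 z.1 - inner ℂ y.1 z.1‖ < ε := by
  rw [← inner_sub_left]
  rw [lt_div_iff₀ (by positivity), Subtype.dist_eq, dist_eq_norm] at h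
  refine lt_of_le_of_lt ((_root_.norm_inner_le_norm _ _).trans ?_) h
  exact mul_le_mul_of_nonneg_left (z.2.trans (le_max_left _ _)) (norm_nonneg _)

theorem inner_mod_right {n : ℕ} (x y z : HBall H n) {ε : ℝ}
    (h : dist x y < ε / max (n : ℝ) 1) : ‖inner ℂ z.1 x.1 - inner ℂ z.1 y.1‖ < ε := by
  rw [← inner_sub_right]
  rw [lt_div_iff₀ (by positivity), Subtype.dist_eq, dist_eq_norm] at h
  refine lt_of_le_of_lt ((_root_.norm_inner_le_norm _ _).trans ?_) h
  rw [mul_comm]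
  exact mul_le_mul_of_nonneg_left (z.2.trans (le_max_left _ _)) (norm_nonneg _)

theorem re_mod_left {n : ℕ} {x y z z' : HBall H n} {ε : ℝ} (hz : z = z')
    (h : dist x y < ε / max (n : ℝ) 1) : |re x z - re y z'| < ε := by
  subst hz
  rw [re, re, ← Complex.sub_re]
  exact (Complex.abs_re_le_norm _).trans_lt (inner_mod_left x y z h)

theorem im_mod_left {n : ℕ} {x y z z' : HBall H n} {ε : ℝ} (hz : z = z')
    (h : dist x y < ε / max (n : ℝ) 1) : |im x z - im y z'| < ε := by
  subst hz
  rw [im, im, ← Complex.sub_im]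
  exact (Complex.abs_im_le_norm _).trans_lt (inner_mod_left x y z h)

theorem re_mod_right {n : ℕ} {x y z z' : HBall H n} {ε : ℝ} (hz : z = z')
    (h : dist x y < ε / max (n : ℝ) 1) : |re z x - re z' y| < ε := by
  subst hz
  rw [re, re, ← Complex.sub_re]
  exact (Complex.abs_re_le_norm _).trans_lt (inner_mod_right x y z h)

theorem im_mod_right {n : ℕ} {x y z z' : HBall H n} {ε : ℝ} (hz : z = z')
    (h : dist x y < ε / max (n : ℝ) 1) : |im z x - im z' y| < ε := by
  subst hz
  rw [im, im, ← Complex.sub_im]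
  exact (Complex.abs_im_le_norm _).trans_lt (inner_mod_right x y z h)

end HBall

/-- The complex Hilbert space `H` as a metric structure. -/
def hilbStr (H : Type u) [NormedAddCommGroup H] [InnerProductSpace ℂ H] [CompleteSpace H] :
    MetricStr.{u} LHilb where
  car n := HBall H n
  met _ := inferInstance
  complete n := HBall.completeSpace n
  nonempty n := ⟨HBall.zero n⟩
  dist_le _ x y := HBall.dist_le x y
  fn f a := match f with
    | .zero n => HBall.zero n
    | .incl _ _ h => HBall.incl (H := H) h a.fst
    | .scale c _ => HBall.scale (H := H) c a.fst
    | .add _ => HBall.add (H := H) a.fst a.snd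
    | .sub _ => HBall.sub (H := H) a.fst a.snd
  rel R a := match R with
    | .re _ => HBall.re (H := H) a.fst a.snd
    | .im _ => HBall.im (H := H) a.fst a.snd
  fn_mod := by
    rintro l s (n | ⟨m, n, hmn⟩ | ⟨c, m⟩ | n | n) i ε hε a b hab h
    · exact i.elim0
    · obtain rfl := Args.index_one i
      exact h
    · obtain rfl := Args.index_one i
      exact HBall.scale_dist (H := H) c _ _ hε h
    · obtain ⟨rfl, h1⟩ | ⟨rfl, h1⟩ := Args.agree_two hab
      · exact HBall.add_mod_left (H := H) h1 h
      · exact HBall.add_mod_right (H := H) h1 h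
    · obtain ⟨rfl, h1⟩ | ⟨rfl, h1⟩ := Args.agree_two hab
      · exact HBall.sub_mod_left (H := H) h1 h
      · exact HBall.sub_mod_right (H := H) h1 h
  rel_mod := by
    rintro l (n | n) i ε hε a b hab h
    · obtain ⟨rfl, h1⟩ | ⟨rfl, h1⟩ := Args.agree_two hab
      · exact HBall.re_mod_left (H := H) h1 h
      · exact HBall.re_mod_right (H := H) h1 h
    · obtain ⟨rfl, h1⟩ | ⟨rfl, h1⟩ := Args.agree_two hab
      · exact HBall.im_mod_left (H := H) h1 h
      · exact HBall.im_mod_right (H := H) h1 h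
  rel_mem := by
    rintro l (n | n) a
    · exact HBall.re_mem (H := H) _ _
    · exact HBall.im_mem (H := H) _ _

section Representations

variable {H : Type u} [NormedAddCommGroup H] [InnerProductSpace ℂ H]

def HBall.act {G : Type u} [Group G] (π : G →* (H ≃ₗᵢ[ℂ] H)) (g : G) {n : ℕ} (x : HBall H n) : HBall H n :=
  ⟨π g x.1, by simpa using x.2⟩

theorem HBall.act_mod_right {G : Type u} [Group G] (π : G →* (H ≃ₗᵢ[ℂ] H)) {n : ℕ} {x x' : HBall H n} {g g' : G} {ε : ℝ}
    (h : g = g') (h' : dist x x' < ε) : dist (HBall.act π g x) (HBall.act π g' x') < ε := by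
  subst h
  simpa [HBall.act, Subtype.dist_eq] using h'

variable {G : Type u} [Group G] [MetricSpace G]

/-- `F n` is a continuity modulus of the group variable of the action on the ball `Bₙ`. -/
def FContinuous (F : ℕ → ℝ → ℝ) (π : G →* (H ≃ₗᵢ[ℂ] H)) : Prop :=
  ∀ (n : ℕ) (ε : ℝ), 0 < ε → ∀ v : H, ‖v‖ ≤ n →
    ∀ g g' : G, dist g g' < F n ε → ‖π g v - π g' v‖ < ε

/-- There is a `(Q, ε)`-almost invariant unit vector. -/
def HasAlmostInvariant (π : G →* (H ≃ₗᵢ[ℂ] H)) (Q : Set G) (ε : ℝ) : Prop :=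
  ∃ v : H, (⨆ x : Q, ‖π x v - v‖) < ε ∧ ‖v‖ = 1

/-- The representation `π` almost contains the unit representation. -/
def AlmostContainsUnit (π : G →* (H ≃ₗᵢ[ℂ] H)) : Prop :=
  ∀ Q : Set G, IsCompact Q → ∀ ε : ℝ, 0 < ε → HasAlmostInvariant π Q ε

/-- The sorts of the structure given by a representation. -/
@[reducible] def GHCar (G H : Type u) [NormedAddCommGroup H] : GHSort → Type u
  | .grp => G
  | .ball n => HBall H n

theorem FContinuous.act_mod_left {F : ℕ → ℝ → ℝ} {π : G →* (H ≃ₗᵢ[ℂ] H)} (hπ : FContinuous F π)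
    {n : ℕ} {x x' : HBall H n} {g g' : G} {ε : ℝ} (hε : 0 < ε) (h : x = x')
    (h' : dist g g' < F n ε) : dist (HBall.act π g x) (HBall.act π g' x') < ε := by
  subst h
  rw [Subtype.dist_eq, dist_eq_norm]
  exact hπ n ε hε _ x.2 _ _ h'

/-- The structure `A(G, H)` of a unitary `F`-representation. -/
def repStr (F : ℕ → ℝ → ℝ) (hG : IsMetricGroup G) [CompleteSpace H]
    (π : G →* (H ≃ₗᵢ[ℂ] H)) (hπ : FContinuous F π) : MetricStr.{u} (LGH F) where
  car := GHCar G H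
  met s := match s with
    | .grp => inferInstanceAs (MetricSpace G)
    | .ball n => inferInstanceAs (MetricSpace (HBall H n))
  complete s := match s with
    | .grp => hG.complete
    | .ball n => HBall.completeSpace n
  nonempty s := match s with
    | .grp => ⟨(1 : G)⟩
    | .ball n => ⟨HBall.zero n⟩
  dist_le s := match s with
    | .grp => hG.dist_le_one
    | .ball _ => HBall.dist_le
  fn f a := match f with
    | .mul => HMul.hMul (α := G) (β := G) (γ := G) a.fst a.snd
    | .inv => Inv.inv (α := G) a.fst
    | .one => (1 : G)
    | .zero n => HBall.zero n
    | .incl _ _ h => HBall.incl (H := H) h a.fst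
    | .scale c _ => HBall.scale (H := H) c a.fst
    | .add _ => HBall.add (H := H) a.fst a.snd
    | .sub _ => HBall.sub (H := H) a.fst a.snd
    | .act _ => HBall.act π a.fst a.snd
  rel R a := match R with
    | .re _ => HBall.re (H := H) a.fst a.snd
    | .im _ => HBall.im (H := H) a.fst a.snd
  fn_mod := by
    rintro l s (_ | _ | _ | n | ⟨m, n, hmn⟩ | ⟨c, m⟩ | n | n | n) i ε hε a b hab h
    · obtain ⟨rfl, h1⟩ | ⟨rfl, h1⟩ := Args.agree_two hab
      · exact hG.mul_mod_left h1 h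
      · exact hG.mul_mod_right h1 h
    · obtain rfl := Args.index_one i
      exact (hG.dist_inv _ _).trans_lt h
    · exact i.elim0
    · exact i.elim0
    · obtain rfl := Args.index_one i
      exact h
    · obtain rfl := Args.index_one i
      exact HBall.scale_dist (H := H) c _ _ hε h
    · obtain ⟨rfl, h1⟩ | ⟨rfl, h1⟩ := Args.agree_two hab
      · exact HBall.add_mod_left (H := H) h1 h
      · exact HBall.add_mod_right (H := H) h1 h
    · obtain ⟨rfl, h1⟩ | ⟨rfl, h1⟩ := Args.agree_two hab
      · exact HBall.sub_mod_left (H := H) h1 h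
      · exact HBall.sub_mod_right (H := H) h1 h
    · obtain ⟨rfl, h1⟩ | ⟨rfl, h1⟩ := Args.agree_two hab
      · exact hπ.act_mod_left hε h1 h
      · exact HBall.act_mod_right π h1 h
  rel_mod := by
    rintro l (n | n) i ε hε a b hab h
    · obtain ⟨rfl, h1⟩ | ⟨rfl, h1⟩ := Args.agree_two hab
      · exact HBall.re_mod_left (H := H) h1 h
      · exact HBall.re_mod_right (H := H) h1 h
    · obtain ⟨rfl, h1⟩ | ⟨rfl, h1⟩ := Args.agree_two hab
      · exact HBall.im_mod_left (H := H) h1 h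
      · exact HBall.im_mod_right (H := H) h1 h
  rel_mem := by
    rintro l (n | n) a
    · exact HBall.re_mem (H := H) _ _
    · exact HBall.im_mem (H := H) _ _

/-- Elements of the sorts of `A(G, H)` as elements of `G` and of `H`. -/
def repStr.toGroup {F : ℕ → ℝ → ℝ} {hG : IsMetricGroup G} [CompleteSpace H]
    {π : G →* (H ≃ₗᵢ[ℂ] H)} {hπ : FContinuous F π}
    (x : (repStr F hG π hπ).car GHSort.grp) : G := x

def repStr.toVec {F : ℕ → ℝ → ℝ} {hG : IsMetricGroup G} [CompleteSpace H]
    {π : G →* (H ≃ₗᵢ[ℂ] H)} {hπ : FContinuous F π} {n : ℕ}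
    (x : (repStr F hG π hπ).car (GHSort.ball n)) : H := Subtype.val (α := H) x

/-- The restriction of a representation to a subgroup `G₀` and a `G₀`-invariant subspace `H₀`. -/
def subRep (π : G →* (H ≃ₗᵢ[ℂ] H)) (G₀ : Subgroup G) (H₀ : Submodule ℂ H)
    (h : ∀ g ∈ G₀, ∀ v ∈ H₀, π g v ∈ H₀) : G₀ →* (H₀ ≃ₗᵢ[ℂ] H₀) where
  toFun g :=
    { toFun := fun v => ⟨π g v, h g g.2 v v.2⟩
      invFun := fun v => ⟨π (g⁻¹ : G₀) v, h _ (g⁻¹).2 v v.2⟩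
      left_inv := fun v => by ext; simp
      right_inv := fun v => by ext; simp
      map_add' := fun v w => by ext; simp
      map_smul' := fun c v => by ext; simp
      norm_map' := fun v => by simp }
  map_one' := by ext; simp
  map_mul' g g' := by ext; simp

end Representations

/-! The theories `K_GH(F)` and `K_δ(F)`. -/

namespace GHTheory

open CFormula GHSort

variable {F : ℕ → ℝ → ℝ}

/-- Terms of the group sort. -/
abbrev GT (F : ℕ → ℝ → ℝ) : Type := CTerm (LGH F) (grp : GHSort)

/-- Terms of the sort `Bₙ`. -/
abbrev BT (F : ℕ → ℝ → ℝ) (n : ℕ) : Type := CTerm (LGH F) (ball n : GHSort)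

def gv (i : ℕ) : GT F := .var (L := LGH F) grp i
def bv (n i : ℕ) : BT F n := .var (L := LGH F) (ball n) i
def gmul (t t' : GT F) : GT F :=
  .app (L := LGH F) GHFn.mul (Args.two (X := CTerm (LGH F)) t t')
def ginv (t : GT F) : GT F := .app (L := LGH F) GHFn.inv (Args.one (X := CTerm (LGH F)) t)
def gone : GT F := .app (L := LGH F) GHFn.one (Args.zero (X := CTerm (LGH F)))
def bzero (n : ℕ) : BT F n := .app (L := LGH F) (GHFn.zero n) (Args.zero (X := CTerm (LGH F)))
def bincl {m n : ℕ} (h : m ≤ n) (t : BT F m) : BT F n :=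
  .app (L := LGH F) (GHFn.incl m n h) (Args.one (X := CTerm (LGH F)) t)
def bscale (c : ℂ) {m : ℕ} (t : BT F m) : BT F (scal c * m) :=
  .app (L := LGH F) (GHFn.scale c m) (Args.one (X := CTerm (LGH F)) t)
def bact {n : ℕ} (g : GT F) (t : BT F n) : BT F n :=
  .app (L := LGH F) (GHFn.act n) (Args.two (X := CTerm (LGH F)) g t)
def badd {n : ℕ} (t t' : BT F n) : BT F (2 * n) :=
  .app (L := LGH F) (GHFn.add n) (Args.two (X := CTerm (LGH F)) t t')
def bsub {n : ℕ} (t t' : BT F n) : BT F (2 * n) :=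
  .app (L := LGH F) (GHFn.sub n) (Args.two (X := CTerm (LGH F)) t t')

def gdist (t t' : GT F) : CFormula (LGH F) := .dist (L := LGH F) (s := grp) t t'
def bdist {n : ℕ} (t t' : BT F n) : CFormula (LGH F) := .dist (L := LGH F) (s := ball n) t t'
def bnorm {n : ℕ} (t : BT F n) : CFormula (LGH F) := bdist t (bzero n)
def bre {n : ℕ} (t t' : BT F n) : CFormula (LGH F) :=
  .rel (L := LGH F) (GHRel.re n) (Args.two (X := CTerm (LGH F)) t t')
def bim {n : ℕ} (t t' : BT F n) : CFormula (LGH F) :=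
  .rel (L := LGH F) (GHRel.im n) (Args.two (X := CTerm (LGH F)) t t')

/-- Sum, distance and inner product of terms of the sorts `Bₘ` and `Bₙ`, computed in `Bₘ₊ₙ`. -/
def vadd {m n : ℕ} (t : BT F m) (t' : BT F n) : BT F (2 * (m + n)) :=
  badd (bincl (m.le_add_right n) t) (bincl (n.le_add_left m) t')
def vdist {m n : ℕ} (t : BT F m) (t' : BT F n) : CFormula (LGH F) :=
  bdist (bincl (m.le_add_right n) t) (bincl (n.le_add_left m) t')
def vre {m n : ℕ} (t : BT F m) (t' : BT F n) : CFormula (LGH F) :=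
  bre (bincl (m.le_add_right n) t) (bincl (n.le_add_left m) t')
def vim {m n : ℕ} (t : BT F m) (t' : BT F n) : CFormula (LGH F) :=
  bim (bincl (m.le_add_right n) t) (bincl (n.le_add_left m) t')

def gsup (i : ℕ) (φ : CFormula (LGH F)) : CFormula (LGH F) := .sup (L := LGH F) grp i φ
def bsup (n i : ℕ) (φ : CFormula (LGH F)) : CFormula (LGH F) := .sup (L := LGH F) (ball n) i φ
def binf (n i : ℕ) (φ : CFormula (LGH F)) : CFormula (LGH F) := .inf (L := LGH F) (ball n) i φ
def gsup3 (φ : CFormula (LGH F)) : CFormula (LGH F) := gsup 0 (gsup 1 (gsup 2 φ))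
def bsup2 (n : ℕ) (φ : CFormula (LGH F)) : CFormula (LGH F) := bsup n 0 (bsup n 1 φ)
def bsup3 (n : ℕ) (φ : CFormula (LGH F)) : CFormula (LGH F) :=
  bsup n 0 (bsup n 1 (bsup n 2 φ))

/-- The group is a group with a bi-invariant metric. -/
inductive GroupAx : CFormula (LGH F) → Prop
  | assoc : GroupAx (gsup3 (gdist (gmul (gmul (gv 0) (gv 1)) (gv 2))
      (gmul (gv 0) (gmul (gv 1) (gv 2)))))
  | one_mul : GroupAx (gsup 0 (gdist (gmul gone (gv 0)) (gv 0)))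
  | mul_one : GroupAx (gsup 0 (gdist (gmul (gv 0) gone) (gv 0)))
  | inv_mul : GroupAx (gsup 0 (gdist (gmul (ginv (gv 0)) (gv 0)) gone))
  | mul_inv : GroupAx (gsup 0 (gdist (gmul (gv 0) (ginv (gv 0))) gone))
  | left_inv : GroupAx (gsup3 (absDiff (gdist (gmul (gv 0) (gv 1)) (gmul (gv 0) (gv 2)))
      (gdist (gv 1) (gv 2))))
  | right_inv : GroupAx (gsup3 (absDiff (gdist (gmul (gv 1) (gv 0)) (gmul (gv 2) (gv 0)))
      (gdist (gv 1) (gv 2))))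

/-- The sorts `Bₙ` are the balls of a complex Hilbert space, whose inner product is linear in the
second variable. -/
inductive HilbertAx : CFormula (LGH F) → Prop
  | incl_self (n : ℕ) : HilbertAx (bsup n 0 (bdist (bincl le_rfl (bv n 0)) (bv n 0)))
  | incl_incl (m n k : ℕ) (h : m ≤ n) (h' : n ≤ k) : HilbertAx (bsup m 0
      (bdist (bincl h' (bincl h (bv m 0))) (bincl (h.trans h') (bv m 0))))
  | incl_zero (m n : ℕ) (h : m ≤ n) : HilbertAx (bdist (bincl h (bzero m)) (bzero n))
  | incl_scale (c : ℂ) (m n : ℕ) (h : m ≤ n) : HilbertAx (bsup m 0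
      (vdist (bscale c (bincl h (bv m 0))) (bscale c (bv m 0))))
  | incl_add (m n : ℕ) (h : m ≤ n) : HilbertAx (bsup2 m
      (vdist (badd (bincl h (bv m 0)) (bincl h (bv m 1))) (badd (bv m 0) (bv m 1))))
  | incl_sub (m n : ℕ) (h : m ≤ n) : HilbertAx (bsup2 m
      (vdist (bsub (bincl h (bv m 0)) (bincl h (bv m 1))) (bsub (bv m 0) (bv m 1))))
  | incl_re (m n : ℕ) (h : m ≤ n) : HilbertAx (bsup2 m
      (absDiff (bre (bincl h (bv m 0)) (bincl h (bv m 1))) (bre (bv m 0) (bv m 1))))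
  | incl_im (m n : ℕ) (h : m ≤ n) : HilbertAx (bsup2 m
      (absDiff (bim (bincl h (bv m 0)) (bincl h (bv m 1))) (bim (bv m 0) (bv m 1))))
  | add_comm (n : ℕ) : HilbertAx (bsup2 n
      (bdist (badd (bv n 0) (bv n 1)) (badd (bv n 1) (bv n 0))))
  | add_assoc (n : ℕ) : HilbertAx (bsup3 n
      (vdist (vadd (badd (bv n 0) (bv n 1)) (bv n 2)) (vadd (bv n 0) (badd (bv n 1) (bv n 2)))))
  | add_zero (n : ℕ) : HilbertAx (bsup n 0 (vdist (badd (bv n 0) (bzero n)) (bv n 0)))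
  | sub_add (n : ℕ) : HilbertAx (bsup2 n
      (vdist (vadd (bsub (bv n 0) (bv n 1)) (bv n 1)) (bv n 0)))
  | one_scale (n : ℕ) : HilbertAx (bsup n 0 (vdist (bscale 1 (bv n 0)) (bv n 0)))
  | mul_scale (c c' : ℂ) (n : ℕ) : HilbertAx (bsup n 0
      (vdist (bscale (c * c') (bv n 0)) (bscale c (bscale c' (bv n 0)))))
  | scale_add (c : ℂ) (n : ℕ) : HilbertAx (bsup2 n
      (vdist (bscale c (badd (bv n 0) (bv n 1)))
        (badd (bscale c (bv n 0)) (bscale c (bv n 1)))))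
  | add_scale (c c' : ℂ) (n : ℕ) : HilbertAx (bsup n 0
      (vdist (bscale (c + c') (bv n 0)) (vadd (bscale c (bv n 0)) (bscale c' (bv n 0)))))
  | re_symm (n : ℕ) : HilbertAx (bsup2 n
      (absDiff (bre (bv n 0) (bv n 1)) (bre (bv n 1) (bv n 0))))
  | im_symm (n : ℕ) : HilbertAx (bsup2 n
      (absDiff (bim (bv n 0) (bv n 1)) (smul (-1) (bim (bv n 1) (bv n 0)))))
  | re_add (n : ℕ) : HilbertAx (bsup3 n
      (absDiff (vre (bv n 0) (badd (bv n 1) (bv n 2)))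
        (plus (bre (bv n 0) (bv n 1)) (bre (bv n 0) (bv n 2)))))
  | im_add (n : ℕ) : HilbertAx (bsup3 n
      (absDiff (vim (bv n 0) (badd (bv n 1) (bv n 2)))
        (plus (bim (bv n 0) (bv n 1)) (bim (bv n 0) (bv n 2)))))
  | re_scale (c : ℂ) (n : ℕ) : HilbertAx (bsup2 n
      (absDiff (vre (bv n 0) (bscale c (bv n 1)))
        (plus (smul c.re (bre (bv n 0) (bv n 1))) (smul (-c.im) (bim (bv n 0) (bv n 1))))))
  | im_scale (c : ℂ) (n : ℕ) : HilbertAx (bsup2 n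
      (absDiff (vim (bv n 0) (bscale c (bv n 1)))
        (plus (smul c.re (bim (bv n 0) (bv n 1))) (smul c.im (bre (bv n 0) (bv n 1))))))
  | dist_sq (n : ℕ) : HilbertAx (bsup2 n
      (absDiff (sq (bdist (bv n 0) (bv n 1)))
        (bre (bsub (bv n 0) (bv n 1)) (bsub (bv n 0) (bv n 1)))))
  | norm_le (n : ℕ) : HilbertAx (bsup n 0 (tsub (bnorm (bv n 0)) (const n)))
  | ball_image (m n : ℕ) (h : m ≤ n) : HilbertAx (bsup n 0 (binf m 1
      (tsub (bdist (bv n 0) (bincl h (bv m 1))) (tsub (bnorm (bv n 0)) (const m)))))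

/-- The maps `G × Bₙ → Bₙ` agree with each other and form a linear unitary action. -/
inductive ActionAx : CFormula (LGH F) → Prop
  | one_act (n : ℕ) : ActionAx (bsup n 0 (bdist (bact gone (bv n 0)) (bv n 0)))
  | mul_act (n : ℕ) : ActionAx (gsup 0 (gsup 1 (bsup n 0
      (bdist (bact (gmul (gv 0) (gv 1)) (bv n 0)) (bact (gv 0) (bact (gv 1) (bv n 0)))))))
  | act_incl (m n : ℕ) (h : m ≤ n) : ActionAx (gsup 0 (bsup m 0
      (bdist (bact (gv 0) (bincl h (bv m 0))) (bincl h (bact (gv 0) (bv m 0))))))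
  | act_add (n : ℕ) : ActionAx (gsup 0 (bsup2 n
      (bdist (bact (gv 0) (badd (bv n 0) (bv n 1)))
        (badd (bact (gv 0) (bv n 0)) (bact (gv 0) (bv n 1))))))
  | act_scale (c : ℂ) (n : ℕ) : ActionAx (gsup 0 (bsup n 0
      (bdist (bact (gv 0) (bscale c (bv n 0))) (bscale c (bact (gv 0) (bv n 0))))))
  | act_re (n : ℕ) : ActionAx (gsup 0 (bsup2 n
      (absDiff (bre (bact (gv 0) (bv n 0)) (bact (gv 0) (bv n 1))) (bre (bv n 0) (bv n 1)))))
  | act_im (n : ℕ) : ActionAx (gsup 0 (bsup2 n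
      (absDiff (bim (bact (gv 0) (bv n 0)) (bact (gv 0) (bv n 1))) (bim (bv n 0) (bv n 1)))))

/-- The axioms of `K_GH(F)`; the moduli `F` are part of the signature. -/
def KGH (F : ℕ → ℝ → ℝ) : Set (CFormula (LGH F)) :=
  {φ | GroupAx φ ∨ HilbertAx φ ∨ ActionAx φ}

/-- The axiom
`sup_{x₀, …, x_k} inf_{v ∈ Bₘ} sup_{x ∈ ⋃ xᵢ K_δ} max (‖x ∘ v - v‖ ∸ 1 / n, |1 - ‖v‖|) = 0`
where the last `sup` is written as
`sup_x min (max_i (δ ∸ d(x, xᵢ)), max (‖x ∘ v - v‖ ∸ 1 / n, |1 - ‖v‖|))`. -/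
def deltaAx (F : ℕ → ℝ → ℝ) (δ : ℝ) (k m n : ℕ) : CFormula (LGH F) :=
  supUpTo (L := LGH F) grp (k + 1) (binf m 0 (gsup (k + 1)
    (fmin (fmaxUpTo (fun i => tsub (const δ) (gdist (gv (k + 1)) (gv i))) k)
      (fmax (tsub (bdist (bact (gv (k + 1)) (bv m 0)) (bv m 0)) (const (1 / n)))
        (absDiff (const 1) (bnorm (bv m 0)))))))

/-- The axioms of `K_δ(F)`. -/
def Kdelta (F : ℕ → ℝ → ℝ) (δ : ℝ) : Set (CFormula (LGH F)) :=
  KGH F ∪ {φ | ∃ k m n : ℕ, 1 ≤ m ∧ 1 ≤ n ∧ φ = deltaAx F δ k m n}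

end GHTheory

end

/-! For (a), left translations are isometries, so local compactness gives one rational `δ` for which
all closed `δ`-balls are compact. The axioms of `K_δ` speak of finite unions of such balls. These
unions are compact, so an almost invariant unit vector for a union witnesses the axiom. Conversely,
a compact `Q` is covered by finitely many balls of radius `δ / 2`. On these the clause `δ ∸ d(x,
xᵢ)` stays above `δ / 2`, so a small value of the axiom forces a small displacement by all of `Q`
and a norm near `1`, and the vector can be normalised.

For (b), take the Hilbert direct sum of the given representations over all pairs of a compact set
and some `1 / (n + 1)`. Coordinates of an invariant vector are invariant, hence zero, and the moduli
survive because the action is linear. The sum has infinite dimension: in finite dimension the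
compactness of the unit sphere would produce an invariant unit vector.

For elementary substructures, both properties have to be expressed by conditions of continuous
logic. Almost containment is expressed by `K_δ`, according to (a). The absence of invariant vectors
is expressed by `sup_v (‖v‖ ∸ sup_x ‖xv - v‖) = 0`: if `G` moves `v` by at most some `r < ‖v‖`, the
point of least norm in the closed convex hull of the orbit is invariant and non-zero
(`exists_invariant_of_forall_norm_sub_le`). The axiom `ball_image` makes the ball sorts of an
elementary substructure the balls of one closed subspace (`mem_ballSet_iff`), and translating
formulas of the two smaller languages gives elementarity of the group and of the Hilbert space. -/

section

/-! ### Semantics: quantifiers, connectives, isomorphism invariance. -/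

namespace MetricStr

variable {L : ContSig} (M : MetricStr.{u} L)

@[simp] theorem upd_same (ρ : M.Asg) (s : L.Srt) (n : ℕ) (a : M.car s) :
    M.upd ρ s n a s n = a := by
  simp [upd]

theorem upd_of_sort_ne (ρ : M.Asg) {s t : L.Srt} (n k : ℕ) (a : M.car s) (h : t ≠ s) :
    M.upd ρ s n a t k = ρ t k := by
  simp [upd, h]

theorem upd_of_index_ne (ρ : M.Asg) (s : L.Srt) {t : L.Srt} {n k : ℕ} (a : M.car s) (h : k ≠ n) :
    M.upd ρ s n a t k = ρ t k := by
  by_cases ht : t = s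
  · subst ht
    simp [upd, h]
  · exact M.upd_of_sort_ne ρ n k a ht

@[simp] theorem upd_self (ρ : M.Asg) (s : L.Srt) (n : ℕ) : M.upd ρ s n (ρ s n) = ρ := by
  simp [upd]

variable {M}

theorem val_sup_eq_zero {φ : CFormula L} (h : ∀ ρ, M.val φ ρ = 0) (s : L.Srt) (n : ℕ)
    (ρ : M.Asg) : M.val (.sup s n φ) ρ = 0 := by
  simp [val, h]

theorem val_inf_eq_zero {φ : CFormula L} {s : L.Srt} {n : ℕ} {ρ : M.Asg}
    (h0 : ∀ ρ, 0 ≤ M.val φ ρ) (h : ∃ a, M.val φ (M.upd ρ s n a) ≤ 0) :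
    M.val (.inf s n φ) ρ = 0 := by
  obtain ⟨a, ha⟩ := h
  simp only [val]
  exact le_antisymm ((ciInf_le ⟨0, by rintro _ ⟨b, rfl⟩; exact h0 _⟩ a).trans ha)
    (Real.iInf_nonneg fun b => h0 _)

/-- The bound `C` matters: a real supremum of an unbounded family has the default value `0`.
Explicit bounds accompany formulas below for this reason. -/
theorem le_val_sup {φ : CFormula L} {s : L.Srt} {n : ℕ} {ρ : M.Asg} {C : ℝ}
    (hC : ∀ ρ, M.val φ ρ ≤ C) (a : M.car s) :
    M.val φ (M.upd ρ s n a) ≤ M.val (.sup s n φ) ρ := by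
  simp only [val]
  exact le_ciSup (f := fun a => M.val φ (M.upd ρ s n a))
    ⟨C, by rintro _ ⟨b, rfl⟩; exact hC _⟩ a

theorem val_sup_mem {φ : CFormula L} {C : ℝ} (h : ∀ ρ, M.val φ ρ ∈ Set.Icc 0 C)
    (s : L.Srt) (n : ℕ) (ρ : M.Asg) : M.val (.sup s n φ) ρ ∈ Set.Icc 0 C := by
  simp only [val]
  exact ⟨Real.iSup_nonneg fun a => (h _).1, ciSup_le fun a => (h _).2⟩

theorem val_inf_mem {φ : CFormula L} {C : ℝ} (h : ∀ ρ, M.val φ ρ ∈ Set.Icc 0 C)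
    (s : L.Srt) (n : ℕ) (ρ : M.Asg) : M.val (.inf s n φ) ρ ∈ Set.Icc 0 C := by
  simp only [val]
  exact ⟨Real.iInf_nonneg fun a => (h _).1,
    (ciInf_le ⟨0, by rintro _ ⟨b, rfl⟩; exact (h _).1⟩ (Classical.arbitrary _)).trans (h _).2⟩

theorem exists_val_lt_of_inf_eq_zero {φ : CFormula L} {s : L.Srt} {n : ℕ} {ρ : M.Asg}
    (h : M.val (.inf s n φ) ρ = 0) {ε : ℝ} (hε : 0 < ε) :
    ∃ a, M.val φ (M.upd ρ s n a) < ε := by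
  simp only [val] at h
  exact exists_lt_of_ciInf_lt (h.trans_lt hε)

theorem val_eq_zero_of_sup {φ : CFormula L} {C : ℝ} (hφ : ∀ ρ, M.val φ ρ ∈ Set.Icc 0 C)
    {s : L.Srt} {n : ℕ} (h : ∀ ρ, M.val (.sup s n φ) ρ = 0) (ρ : M.Asg) : M.val φ ρ = 0 := by
  refine le_antisymm ?_ (hφ ρ).1
  have := le_val_sup (M := M) (φ := φ) (s := s) (n := n) (ρ := ρ) (fun ρ => (hφ ρ).2) (ρ s n)
  rwa [upd_self, h] at this

/-- A supremum of non-negative values vanishes only if all of them do, so a prefix of `sup`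
quantifiers can be stripped once all assignments are considered. -/
theorem val_supUpTo_eq_zero_iff {C : ℝ} (s : L.Srt) (k : ℕ) {φ : CFormula L}
    (hφ : ∀ ρ, M.val φ ρ ∈ Set.Icc 0 C) :
    (∀ ρ, M.val (CFormula.supUpTo s k φ) ρ = 0) ↔ ∀ ρ, M.val φ ρ = 0 := by
  induction k generalizing φ with
  | zero => rfl
  | succ k ih =>
    rw [CFormula.supUpTo, ih fun ρ => val_sup_mem hφ s k ρ]
    exact ⟨fun h => val_eq_zero_of_sup hφ h, fun h => val_sup_eq_zero h s k⟩

/-! Values of the connectives. -/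

open CFormula

@[simp] theorem val_const (r : ℝ) (ρ : M.Asg) : M.val (const r) ρ = r := rfl

@[simp] theorem val_smul (r : ℝ) (φ : CFormula L) (ρ : M.Asg) :
    M.val (CFormula.smul r φ) ρ = r * M.val φ ρ := rfl

@[simp] theorem val_sq (φ : CFormula L) (ρ : M.Asg) : M.val (sq φ) ρ = M.val φ ρ ^ 2 := rfl

@[simp] theorem val_plus (φ ψ : CFormula L) (ρ : M.Asg) :
    M.val (plus φ ψ) ρ = M.val φ ρ + M.val ψ ρ := rfl

@[simp] theorem val_absDiff (φ ψ : CFormula L) (ρ : M.Asg) :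
    M.val (absDiff φ ψ) ρ = |M.val φ ρ - M.val ψ ρ| := rfl

@[simp] theorem val_tsub (φ ψ : CFormula L) (ρ : M.Asg) :
    M.val (tsub φ ψ) ρ = max (M.val φ ρ - M.val ψ ρ) 0 := rfl

@[simp] theorem val_fmin (φ ψ : CFormula L) (ρ : M.Asg) :
    M.val (fmin φ ψ) ρ = min (M.val φ ρ) (M.val ψ ρ) := rfl

@[simp] theorem val_fmax (φ ψ : CFormula L) (ρ : M.Asg) :
    M.val (fmax φ ψ) ρ = max (M.val φ ρ) (M.val ψ ρ) := rfl

theorem val_fmaxUpTo_le_iff (φ : ℕ → CFormula L) (k : ℕ) (ρ : M.Asg) (c : ℝ) :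
    M.val (fmaxUpTo φ k) ρ ≤ c ↔ ∀ i ≤ k, M.val (φ i) ρ ≤ c := by
  induction k with
  | zero => simp [fmaxUpTo]
  | succ k ih =>
    rw [fmaxUpTo, val_fmax, max_le_iff, ih]
    exact ⟨fun h i hi => (Nat.le_succ_iff.1 hi).elim (h.1 i) fun e => e ▸ h.2,
      fun h => ⟨fun i hi => h i (hi.trans k.le_succ), h _ le_rfl⟩⟩

/-! Isomorphic structures have the same theory. -/

namespace Iso

variable {N : MetricStr.{u} L} (e : M.Iso N)

/-- The image of an assignment. -/
def asg (ρ : M.Asg) : N.Asg := fun s n => e.map s (ρ s n)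

theorem asg_upd (ρ : M.Asg) (s : L.Srt) (n : ℕ) (a : M.car s) :
    e.asg (M.upd ρ s n a) = N.upd (e.asg ρ) s n (e.map s a) := by
  funext t k
  by_cases ht : t = s
  · subst ht
    by_cases hk : k = n
    · subst hk
      simp [asg]
    · simp [asg, upd_of_index_ne _ _ _ _ hk]
  · simp [asg, upd_of_sort_ne _ _ _ _ _ ht]

theorem tval_map (ρ : M.Asg) {s : L.Srt} (t : CTerm L s) :
    e.map s (M.tval ρ t) = N.tval (e.asg ρ) t := by
  induction t with
  | var s n => rfl
  | app f a ih => simp only [tval, e.map_fn, ih]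

/-- Since each `e.map s` is a bijection, the quantifiers on both sides range over the same values.
-/
theorem val_map (φ : CFormula L) (ρ : M.Asg) : N.val φ (e.asg ρ) = M.val φ ρ := by
  induction φ generalizing ρ with
  | dist t t' => simp only [val, ← tval_map, e.map_dist]
  | rel R a => simp only [val, e.map_rel, tval_map]
  | conn c φ ih => simp only [val, ih]
  | sup s n φ ih =>
    simp only [val, ← (e.map s).iSup_comp (g := fun b => N.val φ (N.upd (e.asg ρ) s n b)),
      ← asg_upd, ih]
  | inf s n φ ih =>
    simp only [val, ← (e.map s).iInf_comp (g := fun b => N.val φ (N.upd (e.asg ρ) s n b)),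
      ← asg_upd, ih]

theorem models (e : M.Iso N) {T : Set (CFormula L)} (h : M.Models T) : N.Models T := by
  intro φ hφ ρ
  have hρ : e.asg (fun s n => (e.map s).symm (ρ s n)) = ρ := by
    funext s n
    simp [asg]
  rw [← hρ, val_map]
  exact h φ hφ _

end Iso

theorem Sub.IsElementary.models {N : M.Sub} (hN : N.IsElementary) {T : Set (CFormula L)}
    (h : M.Models T) : N.toStr.Models T :=
  fun φ hφ ρ => (hN φ ρ).trans (h φ hφ _)

end MetricStr

end

/-! ### Evaluation in `A(G, H)` and the axioms of `K_GH`. -/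

section

namespace GHTheory

open CFormula GHSort MetricStr

section Values

variable {F : ℕ → ℝ → ℝ} {G : Type u} [Group G] [MetricSpace G] {hG : IsMetricGroup G}
  {H : Type u} [NormedAddCommGroup H] [InnerProductSpace ℂ H] [CompleteSpace H]
  {π : G →* (H ≃ₗᵢ[ℂ] H)} {hπ : FContinuous F π}

/-- The value in `G` of a term of the group sort. -/
noncomputable def gval (ρ : (repStr F hG π hπ).Asg) (t : GT F) : G := repStr.toGroup (MetricStr.tval _ ρ t)

/-- The value in `H` of a term of the sort `Bₙ`. -/
noncomputable def vval (ρ : (repStr F hG π hπ).Asg) {n : ℕ} (t : BT F n) : H :=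
  repStr.toVec (MetricStr.tval _ ρ t)

variable (ρ : (repStr F hG π hπ).Asg)

theorem norm_vval_le {n : ℕ} (t : BT F n) : ‖vval ρ t‖ ≤ n :=
  Subtype.property (p := fun x : H => ‖x‖ ≤ n) (MetricStr.tval _ ρ t)

@[simp] theorem gval_gmul (t t' : GT F) : gval ρ (gmul t t') = gval ρ t * gval ρ t' := rfl

@[simp] theorem gval_ginv (t : GT F) : gval ρ (ginv t) = (gval ρ t)⁻¹ := rfl

@[simp] theorem gval_gone : gval ρ gone = 1 := rfl

@[simp] theorem vval_bzero (n : ℕ) : vval ρ (bzero n) = 0 := rfl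

@[simp] theorem vval_bincl {m n : ℕ} (h : m ≤ n) (t : BT F m) :
    vval ρ (bincl h t) = vval ρ t := rfl

@[simp] theorem vval_bscale (c : ℂ) {m : ℕ} (t : BT F m) :
    vval ρ (bscale c t) = c • vval ρ t := rfl

@[simp] theorem vval_bact {n : ℕ} (g : GT F) (t : BT F n) :
    vval ρ (bact g t) = π (gval ρ g) (vval ρ t) := rfl

@[simp] theorem vval_badd {n : ℕ} (t t' : BT F n) :
    vval ρ (badd t t') = vval ρ t + vval ρ t' := rfl

@[simp] theorem vval_bsub {n : ℕ} (t t' : BT F n) :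
    vval ρ (bsub t t') = vval ρ t - vval ρ t' := rfl

@[simp] theorem vval_vadd {m n : ℕ} (t : BT F m) (t' : BT F n) :
    vval ρ (vadd t t') = vval ρ t + vval ρ t' := rfl

@[simp] theorem val_gdist (t t' : GT F) :
    (repStr F hG π hπ).val (gdist t t') ρ = dist (gval ρ t) (gval ρ t') := rfl

@[simp] theorem val_bdist {n : ℕ} (t t' : BT F n) :
    (repStr F hG π hπ).val (bdist t t') ρ = ‖vval ρ t - vval ρ t'‖ :=
  dist_eq_norm (vval ρ t) (vval ρ t')

@[simp] theorem val_bnorm {n : ℕ} (t : BT F n) :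
    (repStr F hG π hπ).val (bnorm t) ρ = ‖vval ρ t‖ := by
  simp [bnorm]

@[simp] theorem val_bre {n : ℕ} (t t' : BT F n) :
    (repStr F hG π hπ).val (bre t t') ρ = (inner ℂ (vval ρ t) (vval ρ t')).re := rfl

@[simp] theorem val_bim {n : ℕ} (t t' : BT F n) :
    (repStr F hG π hπ).val (bim t t') ρ = (inner ℂ (vval ρ t) (vval ρ t')).im := rfl

@[simp] theorem val_vdist {m n : ℕ} (t : BT F m) (t' : BT F n) :
    (repStr F hG π hπ).val (vdist t t') ρ = ‖vval ρ t - vval ρ t'‖ := by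
  simp [vdist]

@[simp] theorem val_vre {m n : ℕ} (t : BT F m) (t' : BT F n) :
    (repStr F hG π hπ).val (vre t t') ρ = (inner ℂ (vval ρ t) (vval ρ t')).re := rfl

@[simp] theorem val_vim {m n : ℕ} (t : BT F m) (t' : BT F n) :
    (repStr F hG π hπ).val (vim t t') ρ = (inner ℂ (vval ρ t) (vval ρ t')).im := rfl

/-- Change the value of a variable of the sort `Bₙ` to a vector of `H`. -/
noncomputable def updV (n i : ℕ) (v : HBall H n) : (repStr F hG π hπ).Asg :=
  (repStr F hG π hπ).upd ρ (ball n) i v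

/-- Change the value of a variable of the group sort to an element of `G`. -/
noncomputable def updG (i : ℕ) (g : G) : (repStr F hG π hπ).Asg :=
  (repStr F hG π hπ).upd ρ grp i g

@[simp] theorem vval_updV_same (n i : ℕ) (v : HBall H n) :
    vval (updV ρ n i v) (bv n i) = v.1 :=
  congrArg repStr.toVec ((repStr F hG π hπ).upd_same ρ (ball n) i v)

theorem vval_updV_of_ne (m n : ℕ) {i j : ℕ} (v : HBall H n) (h : j ≠ i) :
    vval (updV ρ n i v) (bv m j) = vval ρ (bv m j) :=
  congrArg repStr.toVec
    ((repStr F hG π hπ).upd_of_index_ne ρ (ball n) (t := ball m) v h)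

@[simp] theorem gval_updV (n i j : ℕ) (v : HBall H n) :
    gval (updV ρ n i v) (gv j) = gval ρ (gv j) :=
  congrArg repStr.toGroup ((repStr F hG π hπ).upd_of_sort_ne ρ (s := ball n) (t := grp) i j v
    GHSort.noConfusion)

@[simp] theorem gval_updG_same (i : ℕ) (g : G) : gval (updG ρ i g) (gv i) = g :=
  congrArg repStr.toGroup ((repStr F hG π hπ).upd_same ρ grp i g)

theorem gval_updG_of_ne {i j : ℕ} (g : G) (h : j ≠ i) :
    gval (updG ρ i g) (gv j) = gval ρ (gv j) :=
  congrArg repStr.toGroup ((repStr F hG π hπ).upd_of_index_ne ρ grp g h)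

@[simp] theorem vval_updG (n i j : ℕ) (g : G) :
    vval (updG ρ i g) (bv n j) = vval ρ (bv n j) :=
  congrArg repStr.toVec ((repStr F hG π hπ).upd_of_sort_ne ρ (s := grp) (t := ball n) i j g
    GHSort.noConfusion)

variable {ρ}

theorem val_gsup_eq_zero {φ : CFormula (LGH F)} (h : ∀ ρ, (repStr F hG π hπ).val φ ρ = 0)
    (i : ℕ) (ρ) : (repStr F hG π hπ).val (gsup i φ) ρ = 0 :=
  val_sup_eq_zero h _ _ _

theorem val_gsup3_eq_zero {φ : CFormula (LGH F)} (h : ∀ ρ, (repStr F hG π hπ).val φ ρ = 0)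
    (ρ) : (repStr F hG π hπ).val (gsup3 φ) ρ = 0 :=
  val_gsup_eq_zero (val_gsup_eq_zero (val_gsup_eq_zero h _) _) _ _

theorem val_bsup_eq_zero {φ : CFormula (LGH F)} (h : ∀ ρ, (repStr F hG π hπ).val φ ρ = 0)
    (n i : ℕ) (ρ) : (repStr F hG π hπ).val (bsup n i φ) ρ = 0 :=
  val_sup_eq_zero h _ _ _

theorem val_bsup2_eq_zero {φ : CFormula (LGH F)} (h : ∀ ρ, (repStr F hG π hπ).val φ ρ = 0)
    (n : ℕ) (ρ) : (repStr F hG π hπ).val (bsup2 n φ) ρ = 0 :=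
  val_bsup_eq_zero (val_bsup_eq_zero h _ _) _ _ _

theorem val_bsup3_eq_zero {φ : CFormula (LGH F)} (h : ∀ ρ, (repStr F hG π hπ).val φ ρ = 0)
    (n : ℕ) (ρ) : (repStr F hG π hπ).val (bsup3 n φ) ρ = 0 :=
  val_bsup_eq_zero (val_bsup_eq_zero (val_bsup_eq_zero h _ _) _ _) _ _ _

end Values

/-- Radial retraction onto the ball of radius `r`: a vector outside it is rescaled to norm `r`. This
provides the witness for the axiom `ball_image`. -/
theorem exists_norm_le_norm_sub_le {H : Type*} [NormedAddCommGroup H] [NormedSpace ℂ H] (x : H)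
    {r : ℝ} (hr : 0 ≤ r) : ∃ y : H, ‖y‖ ≤ r ∧ ‖x - y‖ ≤ max (‖x‖ - r) 0 := by
  rcases le_or_gt ‖x‖ r with h | h
  · exact ⟨x, h, by simp⟩
  · have hx : 0 < ‖x‖ := hr.trans_lt h
    refine ⟨((r / ‖x‖ : ℝ) : ℂ) • x, ?_, le_max_of_le_left ?_⟩
    · rw [norm_smul, Complex.norm_real, Real.norm_of_nonneg (by positivity),
        div_mul_cancel₀ _ hx.ne']
    · have : x - ((r / ‖x‖ : ℝ) : ℂ) • x = ((1 - r / ‖x‖ : ℝ) : ℂ) • x := by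
        push_cast
        rw [sub_smul, one_smul]
      rw [this, norm_smul, Complex.norm_real, Real.norm_of_nonneg, sub_mul, one_mul,
        div_mul_cancel₀ _ hx.ne']
      exact sub_nonneg.2 ((div_le_one hx).2 h.le)

section Models

variable {F : ℕ → ℝ → ℝ} {G : Type u} [Group G] [MetricSpace G] (hG : IsMetricGroup G)
  {H : Type u} [NormedAddCommGroup H] [InnerProductSpace ℂ H] [CompleteSpace H]
  (π : G →* (H ≃ₗᵢ[ℂ] H)) (hπ : FContinuous F π)

theorem val_groupAx {φ : CFormula (LGH F)} (h : GroupAx φ) (ρ : (repStr F hG π hπ).Asg) :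
    (repStr F hG π hπ).val φ ρ = 0 := by
  cases h with
  | assoc => exact val_gsup3_eq_zero (fun ρ => by simp [mul_assoc]) ρ
  | left_inv => exact val_gsup3_eq_zero (fun ρ => by simp [hG.left_inv]) ρ
  | right_inv => exact val_gsup3_eq_zero (fun ρ => by simp [hG.right_inv]) ρ
  | _ => exact val_gsup_eq_zero (fun ρ => by simp) _ ρ

theorem val_actionAx {φ : CFormula (LGH F)} (h : ActionAx φ) (ρ : (repStr F hG π hπ).Asg) :
    (repStr F hG π hπ).val φ ρ = 0 := by
  cases h with
  | one_act n => exact val_bsup_eq_zero (fun ρ => by simp) _ _ ρ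
  | mul_act n =>
    exact val_gsup_eq_zero (val_gsup_eq_zero (val_bsup_eq_zero (fun ρ => by simp) _ _) _) _ ρ
  | act_incl m n h =>
    exact val_gsup_eq_zero (val_bsup_eq_zero (fun ρ => by simp) _ _) _ ρ
  | act_scale c n =>
    exact val_gsup_eq_zero (val_bsup_eq_zero (fun ρ => by simp) _ _) _ ρ
  | _ => exact val_gsup_eq_zero (val_bsup2_eq_zero (fun ρ => by simp) _) _ ρ

theorem val_hilbertAx {φ : CFormula (LGH F)} (h : HilbertAx φ) (ρ : (repStr F hG π hπ).Asg) :
    (repStr F hG π hπ).val φ ρ = 0 := by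
  cases h with
  | incl_self n => exact val_bsup_eq_zero (fun ρ => by simp) _ _ ρ
  | incl_incl m n k h h' => exact val_bsup_eq_zero (fun ρ => by simp) _ _ ρ
  | incl_zero m n h => simp
  | incl_scale c m n h => exact val_bsup_eq_zero (fun ρ => by simp) _ _ ρ
  | add_comm n => exact val_bsup2_eq_zero (fun ρ => by simp [_root_.add_comm]) _ ρ
  | add_assoc n => exact val_bsup3_eq_zero (fun ρ => by simp [_root_.add_assoc]) _ ρ
  | add_zero n => exact val_bsup_eq_zero (fun ρ => by simp) _ _ ρ
  | one_scale n => exact val_bsup_eq_zero (fun ρ => by simp) _ _ ρ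
  | mul_scale c c' n => exact val_bsup_eq_zero (fun ρ => by simp [mul_smul]) _ _ ρ
  | add_scale c c' n => exact val_bsup_eq_zero (fun ρ => by simp [add_smul]) _ _ ρ
  | re_symm n =>
    refine val_bsup2_eq_zero (fun ρ => ?_) _ ρ
    rw [val_absDiff, val_bre, val_bre, ← inner_conj_symm, Complex.conj_re, sub_self, abs_zero]
  | im_symm n =>
    refine val_bsup2_eq_zero (fun ρ => ?_) _ ρ
    rw [val_absDiff, val_smul, val_bim, val_bim, ← inner_conj_symm, Complex.conj_im]
    simp
  | re_add n => exact val_bsup3_eq_zero (fun ρ => by simp) _ ρ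
  | im_add n => exact val_bsup3_eq_zero (fun ρ => by simp) _ ρ
  | re_scale c n =>
    exact val_bsup2_eq_zero (fun ρ => by simp [sub_eq_add_neg]) _ ρ
  | im_scale c n =>
    exact val_bsup2_eq_zero (fun ρ => by simp) _ ρ
  | dist_sq n =>
    refine val_bsup2_eq_zero (fun ρ => ?_) _ ρ
    rw [val_absDiff, val_sq, val_bdist, val_bre, vval_bsub]
    exact abs_eq_zero.2 (sub_eq_zero.2 (inner_self_eq_norm_sq (𝕜 := ℂ) _).symm)
  | norm_le n =>
    exact val_bsup_eq_zero (fun ρ => by simpa using norm_vval_le ρ (bv n 0)) _ _ ρ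
  | ball_image m n h =>
    refine val_bsup_eq_zero (fun ρ => val_inf_eq_zero (fun ρ => by simp) ?_) _ _ ρ
    obtain ⟨y, hy, hxy⟩ := exists_norm_le_norm_sub_le (vval ρ (bv n 0)) m.cast_nonneg
    refine ⟨(⟨y, hy⟩ : HBall H m), ?_⟩
    -- Restated through `updV` so that the evaluation lemmas for variables apply.
    change (repStr F hG π hπ).val _ (updV ρ m 1 ⟨y, hy⟩) ≤ 0
    simpa [vval_updV_of_ne] using hxy
  | scale_add c n => exact val_bsup2_eq_zero (fun ρ => by simp) _ ρ
  | sub_add n => exact val_bsup2_eq_zero (fun ρ => by simp) _ ρ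
  | _ => exact val_bsup2_eq_zero (fun ρ => by simp) _ ρ

/-- The structure of a unitary `F`-representation of a metric group satisfies the axioms of
`K_GH(F)`. -/
theorem repStr_models_KGH : (repStr F hG π hπ).Models (KGH F) := by
  rintro φ (h | h | h) ρ
  · exact val_groupAx hG π hπ h ρ
  · exact val_hilbertAx hG π hπ h ρ
  · exact val_actionAx hG π hπ h ρ

end Models

end GHTheory

end

/-! ### Almost invariant vectors and the theories `K_δ`: part (a). -/

section

section AlmostInvariant

variable {G : Type u} [Group G] {H : Type u} [NormedAddCommGroup H] [InnerProductSpace ℂ H]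
  {π : G →* (H ≃ₗᵢ[ℂ] H)} {Q : Set G} {ε : ℝ}

theorem norm_map_sub_le (π : G →* (H ≃ₗᵢ[ℂ] H)) (g : G) (v : H) : ‖π g v - v‖ ≤ 2 * ‖v‖ :=
  (norm_sub_le _ _).trans_eq (by rw [LinearIsometryEquiv.norm_map, two_mul])

/-- The displacement of `v` is bounded by `2 * ‖v‖`, so the supremum over `Q` is a genuine one and
dominates every term. -/
theorem HasAlmostInvariant.exists_forall_lt (h : HasAlmostInvariant π Q ε) :
    ∃ v : H, ‖v‖ = 1 ∧ ∀ x ∈ Q, ‖π x v - v‖ < ε := by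
  obtain ⟨v, hv, hv1⟩ := h
  refine ⟨v, hv1, fun x hx => lt_of_le_of_lt ?_ hv⟩
  exact le_ciSup (f := fun x : Q => ‖π x v - v‖)
    ⟨2 * ‖v‖, by rintro _ ⟨y, rfl⟩; exact norm_map_sub_le π _ _⟩ ⟨x, hx⟩

/-- Pointwise strict bounds could be lost in the supremum, hence the room between `η` and `ε`. The
condition `0 ≤ η` covers empty `Q`, where the supremum is `0`. -/
theorem HasAlmostInvariant.of_forall_le {η : ℝ} (h0 : 0 ≤ η) (hη : η < ε) {v : H} (hv : ‖v‖ = 1)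
    (h : ∀ x ∈ Q, ‖π x v - v‖ ≤ η) : HasAlmostInvariant π Q ε :=
  ⟨v, (Real.iSup_le (fun x : Q => h x x.2) h0).trans_lt hη, hv⟩

theorem HasAlmostInvariant.of_ne_zero {η : ℝ} (h0 : 0 ≤ η) (hη : η < ε) {v : H} (hv : v ≠ 0)
    (h : ∀ x ∈ Q, ‖π x v - v‖ ≤ η * ‖v‖) : HasAlmostInvariant π Q ε := by
  have hv' : 0 < ‖v‖ := norm_pos_iff.2 hv
  refine .of_forall_le (v := ((‖v‖⁻¹ : ℝ) : ℂ) • v) h0 hη ?_ fun x hx => ?_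
  · rw [norm_smul, Complex.norm_real, norm_inv, norm_norm, inv_mul_cancel₀ hv'.ne']
  · rw [map_smul, ← smul_sub, norm_smul, Complex.norm_real, norm_inv, norm_norm,
      inv_mul_le_iff₀ hv', mul_comm]
    exact h x hx

end AlmostInvariant

/-- Closed balls of a small rational radius are compact in a locally compact metric group. -/
theorem IsMetricGroup.exists_isCompact_closedBall {G : Type u} [Group G] [MetricSpace G]
    [LocallyCompactSpace G] (hG : IsMetricGroup G) :
    ∃ δ : ℚ, 0 < δ ∧ δ < 1 ∧ ∀ x : G, IsCompact (Metric.closedBall x (δ : ℝ)) := by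
  obtain ⟨r, hr, hc⟩ := Metric.exists_isCompact_closedBall (1 : G)
  obtain ⟨δ, hδ0, hδ⟩ := exists_rat_btwn (lt_min hr one_pos)
  rw [lt_min_iff] at hδ
  refine ⟨δ, by exact_mod_cast hδ0, by exact_mod_cast hδ.2, fun x => ?_⟩
  -- Left translation by `x` carries the ball around `1` onto the ball around `x`, so one radius
  -- serves all centres.
  have hi : Isometry (fun y : G => x * y) := Isometry.of_dist_eq (hG.left_inv x)
  have hcδ : IsCompact (Metric.closedBall (1 : G) (δ : ℝ)) :=
    hc.of_isClosed_subset Metric.isClosed_closedBall (Metric.closedBall_subset_closedBall hδ.1.le)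
  convert hcδ.image hi.continuous
  ext y
  simp only [Metric.mem_closedBall, Set.mem_image]
  constructor
  · intro h
    refine ⟨x⁻¹ * y, ?_, by simp⟩
    rwa [← hG.left_inv x, mul_inv_cancel_left, mul_one]
  · rintro ⟨z, hz, rfl⟩
    rwa [← hG.left_inv x, mul_one] at hz

namespace GHTheory

open CFormula GHSort MetricStr

variable {F : ℕ → ℝ → ℝ} {δ : ℝ}

/-- The quantifier-free part of `deltaAx`. -/
noncomputable def deltaMatrix (F : ℕ → ℝ → ℝ) (δ : ℝ) (k m n : ℕ) : CFormula (LGH F) :=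
  fmin (fmaxUpTo (fun i => tsub (const δ) (gdist (gv (k + 1)) (gv i))) k)
    (fmax (tsub (bdist (bact (gv (k + 1)) (bv m 0)) (bv m 0)) (const (1 / n)))
      (absDiff (const 1) (bnorm (bv m 0))))

variable {G : Type u} [Group G] [MetricSpace G] {hG : IsMetricGroup G}
  {H : Type u} [NormedAddCommGroup H] [InnerProductSpace ℂ H] [CompleteSpace H]
  {π : G →* (H ≃ₗᵢ[ℂ] H)} {hπ : FContinuous F π}

/-- The upper bound comes from the first clause of the minimum, as `δ ∸ d ≤ δ`. -/
theorem val_deltaMatrix_mem (hδ : 0 < δ) (k m n : ℕ) (ρ : (repStr F hG π hπ).Asg) :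
    (repStr F hG π hπ).val (deltaMatrix F δ k m n) ρ ∈ Set.Icc 0 δ := by
  rw [deltaMatrix, val_fmin]
  constructor
  · refine le_min ?_ (by simp)
    refine le_trans ?_ ((val_fmaxUpTo_le_iff _ k ρ _).1 le_rfl 0 k.zero_le)
    simp
  · refine (min_le_left _ _).trans ((val_fmaxUpTo_le_iff _ _ _ _).2 fun i _ => ?_)
    simp [hδ.le]

theorem val_deltaAx_eq_zero_iff (hδ : 0 < δ) (k m n : ℕ) :
    (∀ ρ, (repStr F hG π hπ).val (deltaAx F δ k m n) ρ = 0) ↔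
      ∀ ρ, (repStr F hG π hπ).val (binf m 0 (gsup (k + 1) (deltaMatrix F δ k m n))) ρ = 0 :=
  val_supUpTo_eq_zero_iff _ _
    (val_inf_mem (val_sup_mem (val_deltaMatrix_mem hδ k m n) _ _) _ _)

theorem models_Kdelta_of_almostContainsUnit (hδ : 0 < δ)
    (hc : ∀ x : G, IsCompact (Metric.closedBall x δ)) (h : AlmostContainsUnit π) :
    (repStr F hG π hπ).Models (Kdelta F δ) := by
  rintro φ (hφ | ⟨k, m, n, hm, hn, rfl⟩)
  · exact repStr_models_KGH hG π hπ φ hφ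
  refine (val_deltaAx_eq_zero_iff hδ k m n).2 fun ρ => ?_
  -- Outside this union every `δ ∸ d(x, xᵢ)` is zero, so the minimum in the axiom vanishes there;
  -- only the points of the union constrain `v`.
  have hQ : IsCompact (⋃ i ∈ Finset.range (k + 1), Metric.closedBall (gval ρ (gv i)) δ) :=
    (Finset.range (k + 1)).isCompact_biUnion fun i _ => hc _
  obtain ⟨v, hv, hvQ⟩ := (h _ hQ (1 / n) (by positivity)).exists_forall_lt
  refine val_inf_eq_zero (fun ρ => (val_sup_mem (val_deltaMatrix_mem hδ k m n) _ _ ρ).1)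
    ⟨(⟨v, hv.le.trans (by exact_mod_cast hm)⟩ : HBall H m), ?_⟩
  refine ciSup_le fun (g : G) => ?_
  change (repStr F hG π hπ).val _ (updG (updV ρ m 0 _) (k + 1) g) ≤ 0
  rw [deltaMatrix, val_fmin, min_le_iff]
  by_cases hg : ∃ i ≤ k, dist g (gval ρ (gv i)) ≤ δ
  · right
    obtain ⟨i, hi, hgi⟩ := hg
    have := hvQ g (by
      simp only [Finset.mem_range, Set.mem_iUnion, Metric.mem_closedBall]
      exact ⟨i, Nat.lt_succ_of_le hi, hgi⟩)
    simpa [hv] using this.le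
  · left
    push Not at hg
    refine (val_fmaxUpTo_le_iff _ _ _ _).2 fun i hi => ?_
    simpa [gval_updG_of_ne _ _ (show i ≠ k + 1 by omega)] using (hg i hi).le

/-- An enumeration of a finite set followed by the unit. -/
theorem exists_enum_finite {M : Type*} [One M] {t : Set M} (ht : t.Finite) :
    ∃ (k : ℕ) (f : ℕ → M), f k = 1 ∧ ∀ x ∈ t, ∃ i ≤ k, f i = x := by
  refine ⟨ht.toFinset.toList.length, fun i => ht.toFinset.toList.getD i 1, by simp, ?_⟩
  intro x hx
  have hx' : x ∈ ht.toFinset.toList := by simpa using hx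
  obtain ⟨i, hi, rfl⟩ := List.mem_iff_getElem.1 hx'
  exact ⟨i, hi.le, List.getD_eq_getElem _ _ hi⟩

theorem almostContainsUnit_of_models_Kdelta (hδ : 0 < δ)
    (h : (repStr F hG π hπ).Models (Kdelta F δ)) : AlmostContainsUnit π := by
  intro Q hQ ε hε
  -- Half the radius, so that `δ ∸ d(x, xᵢ)` stays above `δ / 2` on the covering balls.
  obtain ⟨t, -, ht, hQt⟩ := hQ.finite_cover_balls (half_pos hδ)
  obtain ⟨k, f, hfk, hft⟩ := exists_enum_finite ht
  obtain ⟨n, hn⟩ := exists_nat_one_div_lt (show 0 < ε / 8 by positivity)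
  have hax := (val_deltaAx_eq_zero_iff hδ k 1 (n + 1)).1
    fun ρ => h _ (Or.inr ⟨k, 1, n + 1, le_rfl, by omega, rfl⟩) ρ
  let ρ : (repStr F hG π hπ).Asg := fun s => match s with
    | .grp => f
    | .ball n => fun _ => HBall.zero n
  have hρ : ∀ i, gval ρ (gv i) = f i := fun i => rfl
  -- The bound `δ / 2` rules out the first clause of the minimum, `1 / 2` gives `‖v‖ > 1 / 2`, and
  -- with `1 / (n + 1) < ε / 8` the displacement is below `ε / 8 + ε / 8 = ε / 4 < (ε / 2) * ‖v‖`.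
  have hη : 0 < min (δ / 2) (min (ε / 8) (1 / 2)) := by positivity
  obtain ⟨v, hv⟩ := exists_val_lt_of_inf_eq_zero (hax ρ) hη
  set η := min (δ / 2) (min (ε / 8) (1 / 2))
  have hηδ : η ≤ δ / 2 := min_le_left _ _
  have hηε : η ≤ ε / 8 := (min_le_right _ _).trans (min_le_left _ _)
  have hη2 : η ≤ 1 / 2 := (min_le_right _ _).trans (min_le_right _ _)
  change HBall H 1 at v
  have key : ∀ x : G, (∃ i ≤ k, dist x (f i) < δ / 2) →
      ‖π x v.1 - v.1‖ < 1 / (n + 1) + η ∧ |1 - ‖v.1‖| < η := by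
    rintro x ⟨i, hi, hx⟩
    have h1 := (le_val_sup (s := (grp : GHSort)) (n := k + 1) (ρ := updV ρ 1 0 v)
      (fun ρ => (val_deltaMatrix_mem hδ k 1 (n + 1) ρ).2) x).trans_lt hv
    change (repStr F hG π hπ).val _ (updG (updV ρ 1 0 v) (k + 1) x) < η at h1
    rw [deltaMatrix, val_fmin, min_lt_iff] at h1
    rcases h1 with h1 | h1
    -- Here the first clause would be below `η ≤ δ / 2`, although `x` is within `δ / 2` of `f i`.
    · exfalso
      have h2 := ((val_fmaxUpTo_le_iff _ k _ _).1 le_rfl i hi).trans_lt h1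
      have h3 : δ - dist x (f i) < η := by
        have := (le_max_left _ _).trans_lt (by simpa only [val_tsub] using h2)
        simpa [gval_updG_of_ne _ _ (show i ≠ k + 1 by omega), hρ] using this
      linarith
    · rw [val_fmax, max_lt_iff] at h1
      refine ⟨?_, by simpa using h1.2⟩
      have := (le_max_left _ _).trans_lt (by simpa only [val_tsub] using h1.1)
      simp at this
      rw [one_div]
      linarith
  -- The unit was added to the enumeration as `f k` for this purpose: the norm of `v` is controlled
  -- even if `Q` is empty.
  have hv1 : 1 / 2 < ‖v.1‖ := by
    have := (key 1 ⟨k, le_rfl, by simpa [hfk] using hδ⟩).2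
    linarith [(abs_lt.1 this).2]
  refine .of_ne_zero (η := ε / 2) (by positivity) (by linarith) (v := v.1)
    (norm_pos_iff.1 (by linarith)) fun x hx => ?_
  obtain ⟨y, hy, hxy⟩ := Set.mem_iUnion₂.1 (hQt hx)
  obtain ⟨i, hi, rfl⟩ := hft y hy
  have := (key x ⟨i, hi, hxy⟩).1
  nlinarith

end GHTheory

end

/-! ### Reducts to the languages of metric groups and of Hilbert spaces. -/

section

open MetricStr GHTheory GHSort

variable {F : ℕ → ℝ → ℝ}

namespace MetricStr

variable {L : ContSig} {M : MetricStr.{u} L} (ρ : M.Asg)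

theorem tval_zero :
    (fun i => M.tval ρ (Args.zero (X := CTerm L) i)) = Args.zero := by
  funext i
  exact i.elim0

theorem tval_one {s : L.Srt} (t : CTerm L s) :
    (fun i => M.tval ρ (Args.one (X := CTerm L) t i)) = Args.one (M.tval ρ t) := by
  funext i
  obtain ⟨i, hi⟩ := i
  match i, hi with
  | 0, _ => rfl

theorem tval_two {s s' : L.Srt} (t : CTerm L s) (t' : CTerm L s') :
    (fun i => M.tval ρ (Args.two (X := CTerm L) t t' i)) =
      Args.two (M.tval ρ t) (M.tval ρ t') := by
  funext i
  obtain ⟨i, hi⟩ := i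
  match i, hi with
  | 0, _ => rfl
  | 1, _ => rfl

end MetricStr

/-! The language of metric groups inside that of unitary representations. -/

/-- Terms about metric groups as terms of the group sort. -/
noncomputable def CTerm.ofGrp (F : ℕ → ℝ → ℝ) : ∀ {s : Unit}, CTerm LGrp s → GT F
  | _, .var _ n => gv n
  | _, .app .mul a => gmul (CTerm.ofGrp F (a ⟨0, by simp⟩)) (CTerm.ofGrp F (a ⟨1, by simp⟩))
  | _, .app .inv a => ginv (CTerm.ofGrp F (a ⟨0, by simp⟩))
  | _, .app .one _ => gone

/-- Formulas about metric groups as formulas about unitary representations. -/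
noncomputable def CFormula.ofGrp (F : ℕ → ℝ → ℝ) : CFormula LGrp → CFormula (LGH F)
  | .dist t t' => gdist (CTerm.ofGrp F t) (CTerm.ofGrp F t')
  | .rel R _ => R.elim
  | .conn c φ => .conn c fun i => CFormula.ofGrp F (φ i)
  | .sup _ n φ => .sup (L := LGH F) grp n (CFormula.ofGrp F φ)
  | .inf _ n φ => .inf (L := LGH F) grp n (CFormula.ofGrp F φ)

/-- The metric group `A` is the group sort of `B`. -/
structure IsGrpReduct (A : MetricStr.{u} LGrp) (B : MetricStr.{u} (LGH F)) where
  map : A.car () ≃ B.car grp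
  map_dist : ∀ x y : A.car (), dist (map x) (map y) = dist x y
  map_mul : ∀ a : Args A.car [(), ()],
    map (A.fn GrpFn.mul a) = B.fn GHFn.mul (Args.two (map a.fst) (map a.snd))
  map_inv : ∀ a : Args A.car [()], map (A.fn GrpFn.inv a) = B.fn GHFn.inv (Args.one (map a.fst))
  map_one : ∀ a : Args A.car [], map (A.fn GrpFn.one a) = B.fn GHFn.one Args.zero

namespace IsGrpReduct

variable {A : MetricStr.{u} LGrp} {B : MetricStr.{u} (LGH F)} (e : IsGrpReduct A B)

theorem tval_ofGrp {ρ : A.Asg} {σ : B.Asg} (h : ∀ n, σ grp n = e.map (ρ () n)) :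
    ∀ {s : Unit} (t : CTerm LGrp s), B.tval σ (CTerm.ofGrp F t) = e.map (A.tval ρ t)
  | _, .var _ n => h n
  | _, .app .mul a => (congrArg (B.fn GHFn.mul) ((tval_two σ _ _).trans (congrArg₂ Args.two
      (tval_ofGrp h (a ⟨0, by simp⟩)) (tval_ofGrp h (a ⟨1, by simp⟩))))).trans
        (e.map_mul fun i => A.tval ρ (a i)).symm
  | _, .app .inv a => (congrArg (B.fn GHFn.inv) ((tval_one σ _).trans (congrArg Args.one
      (tval_ofGrp h (a ⟨0, by simp⟩))))).trans (e.map_inv fun i => A.tval ρ (a i)).symm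
  | _, .app .one a => (congrArg (B.fn GHFn.one) (tval_zero σ)).trans
      (e.map_one fun i => A.tval ρ (a i)).symm

/-- Applied both to a substructure and to the whole structure, this lets elementarity descend to the
groups. The ball variables of `σ` are arbitrary, since translated formulas do not mention them. -/
theorem val_ofGrp (φ : CFormula LGrp) {ρ : A.Asg} {σ : B.Asg}
    (h : ∀ n, σ grp n = e.map (ρ () n)) : B.val (CFormula.ofGrp F φ) σ = A.val φ ρ := by
  -- Corresponding updates keep the assignments matched, which is what the quantifier cases need.
  have hupd : ∀ {ρ : A.Asg} {σ : B.Asg}, (∀ n, σ grp n = e.map (ρ () n)) →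
      ∀ (n : ℕ) (a : A.car ()) (k : ℕ),
        B.upd σ grp n (e.map a) grp k = e.map (A.upd ρ () n a () k) := by
    intro ρ σ h n a k
    by_cases hk : k = n
    · subst hk
      simp
    · simp [upd_of_index_ne _ _ _ _ hk, h]
  induction φ generalizing ρ σ with
  | dist t t' =>
    exact (congrArg₂ dist (e.tval_ofGrp h t) (e.tval_ofGrp h t')).trans (e.map_dist _ _)
  | rel R a => exact R.elim
  | conn c φ ih =>
    simp only [CFormula.ofGrp, val]
    exact congrArg c (funext fun i => ih i h)
  | sup s n φ ih =>
    simp only [CFormula.ofGrp, val]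
    exact (e.map.surjective.iSup_congr _ fun a => ih (hupd h n a)).symm
  | inf s n φ ih =>
    simp only [CFormula.ofGrp, val]
    exact (e.map.surjective.iInf_congr _ fun a => ih (hupd h n a)).symm

end IsGrpReduct

/-! The language of Hilbert spaces inside that of unitary representations. -/

/-- Terms about Hilbert spaces as terms about unitary representations. -/
noncomputable def CTerm.ofHilb (F : ℕ → ℝ → ℝ) : ∀ {s : ℕ}, CTerm LHilb s → BT F s
  | _, .var s n => bv s n
  | _, .app (.zero n) _ => bzero n
  | _, .app (.incl _ _ h) a => bincl h (CTerm.ofHilb F (a ⟨0, by simp⟩))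
  | _, .app (.scale c _) a => bscale c (CTerm.ofHilb F (a ⟨0, by simp⟩))
  | _, .app (.add _) a => badd (CTerm.ofHilb F (a ⟨0, by simp⟩)) (CTerm.ofHilb F (a ⟨1, by simp⟩))
  | _, .app (.sub _) a => bsub (CTerm.ofHilb F (a ⟨0, by simp⟩)) (CTerm.ofHilb F (a ⟨1, by simp⟩))

/-- Formulas about Hilbert spaces as formulas about unitary representations. -/
noncomputable def CFormula.ofHilb (F : ℕ → ℝ → ℝ) : CFormula LHilb → CFormula (LGH F)
  | .dist t t' => bdist (CTerm.ofHilb F t) (CTerm.ofHilb F t')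
  | .rel (.re _) a => bre (CTerm.ofHilb F (a ⟨0, by simp⟩)) (CTerm.ofHilb F (a ⟨1, by simp⟩))
  | .rel (.im _) a => bim (CTerm.ofHilb F (a ⟨0, by simp⟩)) (CTerm.ofHilb F (a ⟨1, by simp⟩))
  | .conn c φ => .conn c fun i => CFormula.ofHilb F (φ i)
  | .sup s n φ => .sup (L := LGH F) (ball s) n (CFormula.ofHilb F φ)
  | .inf s n φ => .inf (L := LGH F) (ball s) n (CFormula.ofHilb F φ)

/-- The Hilbert space `A` consists of the ball sorts of `B`. -/
structure IsHilbReduct (A : MetricStr.{u} LHilb) (B : MetricStr.{u} (LGH F)) where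
  map : ∀ n : ℕ, A.car n ≃ B.car (ball n)
  map_dist : ∀ (n : ℕ) (x y : A.car n), dist (map n x) (map n y) = dist x y
  map_zero : ∀ (n : ℕ) (a : Args A.car []),
    map n (A.fn (.zero n) a) = B.fn (.zero n) Args.zero
  map_incl : ∀ (m n : ℕ) (h : m ≤ n) (a : Args A.car [m]),
    map n (A.fn (.incl m n h) a) = B.fn (.incl m n h) (Args.one (map m a.fst))
  map_scale : ∀ (c : ℂ) (m : ℕ) (a : Args A.car [m]),
    map _ (A.fn (.scale c m) a) = B.fn (.scale c m) (Args.one (map m a.fst))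
  map_add : ∀ (n : ℕ) (a : Args A.car [n, n]),
    map _ (A.fn (.add n) a) = B.fn (.add n) (Args.two (map n a.fst) (map n a.snd))
  map_sub : ∀ (n : ℕ) (a : Args A.car [n, n]),
    map _ (A.fn (.sub n) a) = B.fn (.sub n) (Args.two (map n a.fst) (map n a.snd))
  map_re : ∀ (n : ℕ) (a : Args A.car [n, n]),
    B.rel (.re n) (Args.two (map n a.fst) (map n a.snd)) = A.rel (.re n) a
  map_im : ∀ (n : ℕ) (a : Args A.car [n, n]),
    B.rel (.im n) (Args.two (map n a.fst) (map n a.snd)) = A.rel (.im n) a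

namespace IsHilbReduct

variable {A : MetricStr.{u} LHilb} {B : MetricStr.{u} (LGH F)} (e : IsHilbReduct A B)

theorem tval_ofHilb {ρ : A.Asg} {σ : B.Asg} (h : ∀ s n, σ (ball s) n = e.map s (ρ s n)) :
    ∀ {s : ℕ} (t : CTerm LHilb s), B.tval σ (CTerm.ofHilb F t) = e.map s (A.tval ρ t)
  | _, .var s n => h s n
  | _, .app (.zero n) a => (congrArg (B.fn (.zero n)) (tval_zero σ)).trans
      (e.map_zero n fun i => A.tval ρ (a i)).symm
  | _, .app (.incl m n hmn) a => (congrArg (B.fn (.incl m n hmn)) ((tval_one σ _).trans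
      (congrArg Args.one (tval_ofHilb h (a ⟨0, by simp⟩))))).trans
        (e.map_incl m n hmn fun i => A.tval ρ (a i)).symm
  | _, .app (.scale c m) a => (congrArg (B.fn (.scale c m)) ((tval_one σ _).trans
      (congrArg Args.one (tval_ofHilb h (a ⟨0, by simp⟩))))).trans
        (e.map_scale c m fun i => A.tval ρ (a i)).symm
  | _, .app (.add n) a => (congrArg (B.fn (.add n)) ((tval_two σ _ _).trans (congrArg₂ Args.two
      (tval_ofHilb h (a ⟨0, by simp⟩)) (tval_ofHilb h (a ⟨1, by simp⟩))))).trans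
        (e.map_add n fun i => A.tval ρ (a i)).symm
  | _, .app (.sub n) a => (congrArg (B.fn (.sub n)) ((tval_two σ _ _).trans (congrArg₂ Args.two
      (tval_ofHilb h (a ⟨0, by simp⟩)) (tval_ofHilb h (a ⟨1, by simp⟩))))).trans
        (e.map_sub n fun i => A.tval ρ (a i)).symm

/-- The counterpart of `val_ofGrp` for the ball sorts; here the group variables of `σ` are
arbitrary. -/
theorem val_ofHilb (φ : CFormula LHilb) {ρ : A.Asg} {σ : B.Asg}
    (h : ∀ s n, σ (ball s) n = e.map s (ρ s n)) :
    B.val (CFormula.ofHilb F φ) σ = A.val φ ρ := by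
  have hupd : ∀ {ρ : A.Asg} {σ : B.Asg}, (∀ s n, σ (ball s) n = e.map s (ρ s n)) →
      ∀ (s n : ℕ) (a : A.car s) (t k : ℕ),
        B.upd σ (ball s) n (e.map s a) (ball t) k = e.map t (A.upd ρ s n a t k) := by
    intro ρ σ h s n a t k
    by_cases ht : t = s
    · subst ht
      by_cases hk : k = n
      · subst hk
        simp
      · simp [upd_of_index_ne _ _ _ _ hk, h]
    · rw [upd_of_sort_ne A _ _ _ _ ht, ← h]
      exact upd_of_sort_ne B _ _ _ _ fun e => ht (GHSort.ball.inj e)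
  induction φ generalizing ρ σ with
  | dist t t' =>
    exact (congrArg₂ dist (e.tval_ofHilb h t) (e.tval_ofHilb h t')).trans (e.map_dist _ _ _)
  | rel R a =>
    cases R with
    | re n =>
      exact (congrArg (B.rel (.re n)) ((tval_two σ _ _).trans (congrArg₂ Args.two
        (e.tval_ofHilb h (a ⟨0, by simp⟩)) (e.tval_ofHilb h (a ⟨1, by simp⟩))))).trans
          (e.map_re n fun i => A.tval ρ (a i))
    | im n =>
      exact (congrArg (B.rel (.im n)) ((tval_two σ _ _).trans (congrArg₂ Args.two
        (e.tval_ofHilb h (a ⟨0, by simp⟩)) (e.tval_ofHilb h (a ⟨1, by simp⟩))))).trans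
          (e.map_im n fun i => A.tval ρ (a i))
  | conn c φ ih =>
    simp only [CFormula.ofHilb, val]
    exact congrArg c (funext fun i => ih i h)
  | sup s n φ ih =>
    simp only [CFormula.ofHilb, val]
    exact ((e.map s).surjective.iSup_congr _ fun a => ih (hupd h s n a)).symm
  | inf s n φ ih =>
    simp only [CFormula.ofHilb, val]
    exact ((e.map s).surjective.iInf_congr _ fun a => ih (hupd h s n a)).symm

end IsHilbReduct

end

/-! ### Invariant vectors and a condition that excludes them. -/

section

open MetricStr GHTheory GHSort CFormula

section Invariant

variable {G : Type*} [Group G] {H : Type*} [NormedAddCommGroup H] [InnerProductSpace ℂ H]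

/-- A vector which is moved by the whole group by less than its norm yields a non-zero invariant
vector, namely the element of least norm of the closed convex hull of its orbit. -/
theorem exists_invariant_of_forall_norm_sub_le [CompleteSpace H] (π : G →* (H ≃ₗᵢ[ℂ] H)) {v : H}
    {r : ℝ} (hr : r < ‖v‖) (h : ∀ g, ‖π g v - v‖ ≤ r) : ∃ w : H, w ≠ 0 ∧ ∀ g, π g w = w := by
  let : InnerProductSpace ℝ H := InnerProductSpace.rclikeToReal ℂ H
  let S : Set H := Set.range fun g => π g v
  let K : Set H := closure (convexHull ℝ S)
  have hK : Convex ℝ K := (convex_convexHull ℝ S).closure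
  have hvK : v ∈ K := subset_closure (subset_convexHull ℝ S ⟨1, by simp⟩)
  -- As `r < ‖v‖`, this ball omits `0`, which will make the point of least norm non-zero.
  have hKb : K ⊆ Metric.closedBall v r := by
    refine closure_minimal (convexHull_min ?_ (convex_closedBall v r)) Metric.isClosed_closedBall
    rintro _ ⟨g, rfl⟩
    simpa [dist_eq_norm] using h g
  have hKg : ∀ g, ∀ x ∈ K, π g x ∈ K := by
    intro g x hx
    refine map_mem_closure (π g).continuous hx fun y hy => ?_
    let f : H →ₗ[ℝ] H :=
      { toFun := π g
        map_add' := map_add _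
        map_smul' := fun c x => map_smul (π g) (c : ℂ) x }
    have hsub : convexHull ℝ S ⊆ f ⁻¹' convexHull ℝ S := by
      refine convexHull_min ?_ ((convex_convexHull ℝ S).linear_preimage _)
      rintro _ ⟨k, rfl⟩
      exact subset_convexHull ℝ S ⟨g * k, by simp [f]⟩
    exact hsub hy
  obtain ⟨w, hwK, hw⟩ := exists_norm_eq_iInf_of_complete_convex ⟨v, hvK⟩
    isClosed_closure.isComplete hK (0 : H)
  -- The variational inequality holds at every point of `K` of least norm, in particular at `w` and
  -- at its translates.
  have hmin : ∀ x ∈ K, ‖x‖ = ‖w‖ → ∀ y ∈ K, inner ℝ (0 - x) (y - x) ≤ 0 := by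
    intro x hx hxw
    refine (norm_eq_iInf_iff_real_inner_le_zero hK hx).1 ?_
    rw [← hw]
    simpa using hxw
  refine ⟨w, ?_, fun g => ?_⟩
  · rintro rfl
    have := hKb hwK
    rw [mem_closedBall_iff_norm, zero_sub, norm_neg] at this
    linarith
  · have h1 := hmin w hwK rfl _ (hKg g w hwK)
    have h2 := hmin _ (hKg g w hwK) (by simp) w hwK
    -- Adding the inequalities at `w` and at `π g w` yields `‖π g w - w‖² ≤ 0`.
    have h3 : inner ℝ (π g w - w) (π g w - w) ≤ 0 := by
      have : inner ℝ (π g w - w) (π g w - w) =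
          inner ℝ (0 - w) (π g w - w) + inner ℝ (0 - π g w) (w - π g w) := by
        simp only [inner_sub_left, inner_sub_right, inner_zero_left]
        ring
      linarith
    exact sub_eq_zero.1 (real_inner_self_nonpos.1 h3)

/-- A finite-dimensional representation which almost contains the unit representation contains
it. -/
theorem AlmostContainsUnit.exists_invariant {G : Type u} [Group G] [MetricSpace G] {H : Type u}
    [NormedAddCommGroup H] [InnerProductSpace ℂ H] [FiniteDimensional ℂ H]
    {π : G →* (H ≃ₗᵢ[ℂ] H)} (h : AlmostContainsUnit π) :
    ∃ v : H, ‖v‖ = 1 ∧ ∀ g, π g v = v := by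
  have : ProperSpace H := FiniteDimensional.proper ℂ H
  -- Finite intersection property on the unit sphere: finitely many pairs `(g, n)` involve a finite,
  -- hence compact, set of group elements and a largest `n`.
  obtain ⟨v, hv, hvt⟩ := (isCompact_sphere (0 : H) 1).inter_iInter_nonempty
    (fun p : G × ℕ => {v : H | ‖π p.1 v - v‖ ≤ 1 / ((p.2 : ℝ) + 1)})
    (fun p => isClosed_le (((π p.1).continuous.sub continuous_id).norm) continuous_const)
    (fun u => by
      classical
      obtain ⟨v, hv, hvu⟩ := (h (u.image Prod.fst) (u.image Prod.fst).finite_toSet.isCompact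
        (1 / ((u.sup Prod.snd : ℕ) + 1 : ℝ)) (by positivity)).exists_forall_lt
      refine ⟨v, by simpa using hv, Set.mem_iInter₂.2 fun p hp => ?_⟩
      refine (hvu p.1 (by simpa using ⟨p.2, hp⟩)).le.trans ?_
      have : p.2 ≤ u.sup Prod.snd := Finset.le_sup (f := Prod.snd) hp
      gcongr)
  refine ⟨v, by simpa using hv, fun g => sub_eq_zero.1 (norm_le_zero_iff.1 ?_)⟩
  refine le_of_forall_pos_lt_add fun ε hε => ?_
  obtain ⟨n, hn⟩ := exists_nat_one_div_lt hε
  rw [zero_add]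
  exact (Set.mem_iInter.1 hvt (g, n)).trans_lt hn

end Invariant

namespace GHTheory

/-- The formula `sup_{v ∈ B₁} (‖v‖ ∸ sup_x ‖xv - v‖)`. -/
noncomputable def displacement (F : ℕ → ℝ → ℝ) : CFormula (LGH F) :=
  bsup 1 0 (tsub (bnorm (bv 1 0)) (gsup 0 (bdist (bact (gv 0) (bv 1 0)) (bv 1 0))))

variable {F : ℕ → ℝ → ℝ} {G : Type u} [Group G] [MetricSpace G] {hG : IsMetricGroup G}
  {H : Type u} [NormedAddCommGroup H] [InnerProductSpace ℂ H] [CompleteSpace H]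
  {π : G →* (H ≃ₗᵢ[ℂ] H)} {hπ : FContinuous F π}

theorem val_gsup_displacement (ρ : (repStr F hG π hπ).Asg) :
    (repStr F hG π hπ).val (gsup 0 (bdist (bact (gv 0) (bv 1 0)) (bv 1 0))) ρ =
      ⨆ g : G, ‖π g (vval ρ (bv 1 0)) - vval ρ (bv 1 0)‖ := by
  refine iSup_congr (ι := G) fun g => ?_
  change (repStr F hG π hπ).val _ (updG ρ 0 g) = _
  simp

/-- A positive value would give a vector whose displacement by all of `G` is smaller than its norm,
hence a non-zero invariant vector. -/
theorem val_displacement_of_no_invariant (h : ¬ ∃ v : H, v ≠ 0 ∧ ∀ g, π g v = v)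
    (ρ : (repStr F hG π hπ).Asg) : (repStr F hG π hπ).val (displacement F) ρ = 0 := by
  refine val_bsup_eq_zero (fun ρ => ?_) _ _ ρ
  rw [val_tsub, val_gsup_displacement, val_bnorm]
  refine max_eq_right (sub_nonpos.2 ?_)
  by_contra! hlt
  exact h (exists_invariant_of_forall_norm_sub_le π hlt fun g =>
    le_ciSup (f := fun g : G => ‖π g (vval ρ (bv 1 0)) - vval ρ (bv 1 0)‖)
      ⟨2 * ‖vval ρ (bv 1 0)‖, by rintro _ ⟨y, rfl⟩; exact norm_map_sub_le π _ _⟩ g)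

/-- At a fixed unit vector the matrix of the formula takes the value `1`. Together with the
preceding lemma this carries the absence of fixed unit vectors to elementary substructures. -/
theorem no_invariant_of_val_displacement
    (h : ∀ ρ, (repStr F hG π hπ).val (displacement F) ρ = 0) :
    ¬ ∃ v : H, ‖v‖ = 1 ∧ ∀ g, π g v = v := by
  rintro ⟨v, hv, hvg⟩
  have hmem : ∀ ρ, (repStr F hG π hπ).val
      (tsub (bnorm (bv 1 0)) (gsup 0 (bdist (bact (gv 0) (bv 1 0)) (bv 1 0)))) ρ ∈
        Set.Icc (0 : ℝ) 1 := by
    intro ρ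
    rw [val_tsub, val_gsup_displacement, val_bnorm]
    refine ⟨le_max_right _ _, max_le ?_ zero_le_one⟩
    have h1 := norm_vval_le ρ (bv 1 0)
    have h2 : 0 ≤ ⨆ g : G, ‖π g (vval ρ (bv 1 0)) - vval ρ (bv 1 0)‖ :=
      Real.iSup_nonneg fun g => norm_nonneg _
    push_cast at h1
    linarith
  have := val_eq_zero_of_sup hmem h
    (updV (Classical.arbitrary (repStr F hG π hπ).Asg) 1 0 ⟨v, by simp [hv]⟩)
  rw [val_tsub, val_gsup_displacement, val_bnorm] at this
  simp [hv, hvg] at this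

end GHTheory

end

/-! ### Direct sums of unitary representations. -/

section

open scoped lp ENNReal

section DirectSum

variable {ι : Type*} {E : ι → Type*} [∀ i, NormedAddCommGroup (E i)]
  [∀ i, InnerProductSpace ℂ (E i)]

/-- The direct sum of isometries of Hilbert spaces. -/
noncomputable def lp.mapIsometry (e : ∀ i, E i ≃ₗᵢ[ℂ] E i) : lp E 2 ≃ₗᵢ[ℂ] lp E 2 where
  toFun v := ⟨fun i => e i (v i), (lp.memℓp v).mono' fun i => (e i).norm_map _ |>.le⟩
  invFun v := ⟨fun i => (e i).symm (v i), (lp.memℓp v).mono' fun i => (e i).symm.norm_map _ |>.le⟩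
  left_inv _ := lp.ext (funext fun i => (e i).symm_apply_apply _)
  right_inv _ := lp.ext (funext fun i => (e i).apply_symm_apply _)
  map_add' _ _ := lp.ext (funext fun i => map_add (e i) _ _)
  map_smul' c _ := lp.ext (funext fun i => map_smul (e i) c _)
  norm_map' v := le_antisymm
    (lp.norm_mono two_ne_zero fun i => ((e i).norm_map (v i)).le)
    (lp.norm_mono two_ne_zero fun i => ((e i).norm_map (v i)).ge)

@[simp] theorem lp.mapIsometry_apply (e : ∀ i, E i ≃ₗᵢ[ℂ] E i) (v : lp E 2) (i : ι) :
    lp.mapIsometry e v i = e i (v i) := rfl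

/-- The direct sum of unitary representations. -/
noncomputable def sumRep {G : Type*} [Group G] (π : ∀ i, G →* (E i ≃ₗᵢ[ℂ] E i)) :
    G →* (lp E 2 ≃ₗᵢ[ℂ] lp E 2) where
  toFun g := lp.mapIsometry fun i => π i g
  map_one' := by
    ext v i
    simp
  map_mul' g g' := by
    ext v i
    simp

@[simp] theorem sumRep_apply {G : Type*} [Group G] (π : ∀ i, G →* (E i ≃ₗᵢ[ℂ] E i)) (g : G)
    (v : lp E 2) (i : ι) : sumRep π g v i = π i g (v i) := rfl

theorem sumRep_single {G : Type*} [Group G] [DecidableEq ι] (π : ∀ i, G →* (E i ≃ₗᵢ[ℂ] E i))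
    (g : G) (i : ι) (v : E i) : sumRep π g (lp.single 2 i v) = lp.single 2 i (π i g v) := by
  ext j
  rw [sumRep_apply]
  by_cases h : j = i
  · subst h
    rw [lp.single_apply_self, lp.single_apply_self]
  · rw [lp.single_apply_ne _ _ _ h, lp.single_apply_ne _ _ _ h, map_zero]

/-- The squares of the coordinates are compared termwise. Strictness at one non-zero coordinate of
`v` suffices for the sums, and coordinates where `v` vanishes are treated apart because no strict
inequality holds there. -/
theorem lp.norm_lt_of_forall_lt {ι : Type*} {E : ι → Type*} [∀ i, NormedAddCommGroup (E i)]
    {v w : lp E 2} {c r : ℝ} (hv : v ≠ 0)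
    (hle : ∀ i, v i ≠ 0 → ‖w i‖ < c * ‖v i‖) (h0 : ∀ i, v i = 0 → w i = 0)
    (hc : 0 < c) (hr : c * ‖v‖ ≤ r) : ‖w‖ < r := by
  have h2 : 0 < (2 : ℝ≥0∞).toReal := by norm_num
  obtain ⟨i, hi⟩ : ∃ i, v i ≠ 0 := by
    by_contra! h
    exact hv (lp.ext (funext h))
  have hw := lp.hasSum_norm h2 w
  have hv' := (lp.hasSum_norm h2 v).mul_left (c ^ (2 : ℝ≥0∞).toReal)
  have hlt : ‖w‖ ^ (2 : ℝ≥0∞).toReal < (c * ‖v‖) ^ (2 : ℝ≥0∞).toReal := by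
    rw [Real.mul_rpow hc.le (norm_nonneg _)]
    refine hasSum_lt (i := i) (fun j => ?_) ?_ hw hv'
    · by_cases hj : v j = 0
      · simp [hj, h0 j hj]
      · beta_reduce
        rw [← Real.mul_rpow hc.le (norm_nonneg _)]
        exact Real.rpow_le_rpow (norm_nonneg _) (hle j hj).le h2.le
    · rw [← Real.mul_rpow hc.le (norm_nonneg _)]
      exact Real.rpow_lt_rpow (norm_nonneg _) (hle i hi) h2
  exact ((Real.rpow_lt_rpow_iff (norm_nonneg _) (by positivity) h2).1 hlt).trans_le hr

end DirectSum

section SumRep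

variable {G : Type u} [Group G] {ι : Type u} {E : ι → Type u}
  [∀ i, NormedAddCommGroup (E i)] [∀ i, InnerProductSpace ℂ (E i)]
  {π : ∀ i, G →* (E i ≃ₗᵢ[ℂ] E i)}

/-- By homogeneity, the continuity moduli of the summands are moduli of the direct sum. -/
theorem FContinuous.sumRep [MetricSpace G] {F : ℕ → ℝ → ℝ} (h : ∀ i, FContinuous F (π i)) :
    FContinuous F (sumRep π) := by
  intro n ε hε v hv g g' hg
  -- The zero vector is separated so that `n` is positive and `ε / n` makes sense.
  by_cases hv0 : v = 0
  · simpa [hv0] using hε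
  have hn : (0 : ℝ) < n := (norm_pos_iff.2 hv0).trans_le hv
  refine lp.norm_lt_of_forall_lt (c := ε / n) hv0 (fun i hi => ?_) (fun i hi => ?_)
    (by positivity) ?_
  · have hi' : 0 < ‖v i‖ := norm_pos_iff.2 hi
    -- Rescaling `v i` to norm exactly `n` turns the modulus into the relative bound `(ε / n) * ‖v
    -- i‖`, which can be summed.
    have := h i n ε hε (((n / ‖v i‖ : ℝ) : ℂ) • v i) (by
      rw [norm_smul, Complex.norm_real, Real.norm_of_nonneg (by positivity),
        div_mul_cancel₀ _ hi'.ne']) g g' hg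
    rw [map_smul, map_smul, ← smul_sub, norm_smul, Complex.norm_real,
      Real.norm_of_nonneg (by positivity), div_mul_eq_mul_div, div_lt_iff₀ hi'] at this
    rw [div_mul_eq_mul_div, lt_div_iff₀ hn, mul_comm]
    exact this
  · simp [hi]
  · rw [div_mul_eq_mul_div, div_le_iff₀ hn]
    gcongr

theorem HasAlmostInvariant.sumRep {Q : Set G} {ε : ℝ} {i : ι}
    (h : HasAlmostInvariant (π i) Q ε) : HasAlmostInvariant (sumRep π) Q ε := by
  classical
  obtain ⟨v, hvQ, hv⟩ := h
  have h2 : (0 : ℝ≥0∞) < 2 := by norm_num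
  refine ⟨lp.single 2 i v, ?_, by rw [lp.norm_single h2, hv]⟩
  convert hvQ using 5 with x
  rw [sumRep_single, ← lp.single_sub, lp.norm_single h2]

theorem sumRep_no_invariant (h : ∀ i, ¬ ∃ v : E i, v ≠ 0 ∧ ∀ g, π i g v = v) :
    ¬ ∃ v : lp E 2, v ≠ 0 ∧ ∀ g, sumRep π g v = v := by
  rintro ⟨v, hv, hvg⟩
  refine hv (lp.ext (funext fun i => ?_))
  by_contra hi
  refine h i ⟨v i, hi, fun g => ?_⟩
  rw [← sumRep_apply, hvg]

end SumRep

/-- A direct sum of `F`-representations without non-zero invariant vectors which witness all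
instances of almost invariance. -/
theorem exists_almostContainsUnit_no_invariant {F : ℕ → ℝ → ℝ} {G : Type u} [Group G]
    [MetricSpace G]
    (h : ∀ Q : Set G, IsCompact Q → ∀ ε : ℝ, 0 < ε →
      ∃ (H : Type u) (_ : NormedAddCommGroup H) (_ : InnerProductSpace ℂ H)
        (_ : CompleteSpace H) (π : G →* (H ≃ₗᵢ[ℂ] H)),
        FContinuous F π ∧ HasAlmostInvariant π Q ε ∧ ¬ ∃ v : H, v ≠ 0 ∧ ∀ g : G, π g v = v) :
    ∃ (H : Type u) (_ : NormedAddCommGroup H) (_ : InnerProductSpace ℂ H)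
      (_ : CompleteSpace H) (π : G →* (H ≃ₗᵢ[ℂ] H)),
      FContinuous F π ∧ AlmostContainsUnit π ∧ ¬ ∃ v : H, v ≠ 0 ∧ ∀ g : G, π g v = v := by
  -- One summand for each compact set and each tolerance `1 / (n + 1)`; these tolerances are
  -- cofinal.
  choose E _ _ _ π hF hπ hinv using fun p : {Q : Set G // IsCompact Q} × ℕ =>
    h p.1.1 p.1.2 (1 / ((p.2 : ℝ) + 1)) (by positivity)
  refine ⟨lp E 2, inferInstance, inferInstance, inferInstance, sumRep π, .sumRep hF,
    fun Q hQ ε hε => ?_, sumRep_no_invariant hinv⟩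
  obtain ⟨n, hn⟩ := exists_nat_one_div_lt hε
  obtain ⟨v, hvQ, hv⟩ := (hπ (⟨Q, hQ⟩, n)).sumRep
  exact ⟨v, hvQ.trans hn, hv⟩

end

/-! ### Elementary substructures of `A(G, H)`. -/

section

open MetricStr GHTheory GHSort CFormula

theorem FContinuous.subRep {F : ℕ → ℝ → ℝ} {G : Type u} [Group G] [MetricSpace G] {H : Type u}
    [NormedAddCommGroup H] [InnerProductSpace ℂ H] {π : G →* (H ≃ₗᵢ[ℂ] H)}
    (hπ : FContinuous F π) (G₀ : Subgroup G) (H₀ : Submodule ℂ H)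
    (h : ∀ g ∈ G₀, ∀ v ∈ H₀, π g v ∈ H₀) : FContinuous F (subRep π G₀ H₀ h) :=
  fun n ε hε v hv g g' hg => hπ n ε hε v hv g g' hg

section ElementarySub

variable {F : ℕ → ℝ → ℝ} {G : Type u} [Group G] [MetricSpace G] {hG : IsMetricGroup G}
  {H : Type u} [NormedAddCommGroup H] [InnerProductSpace ℂ H] [CompleteSpace H]
  {π : G →* (H ≃ₗᵢ[ℂ] H)} {hπ : FContinuous F π}

theorem Args.forall_one {S : Type} {X : S → Type u} {s : S} {x : X s} {p : ∀ s, Set (X s)}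
    (h : x ∈ p s) (i : Fin [s].length) : Args.one (X := X) x i ∈ p ([s].get i) := by
  obtain ⟨i, hi⟩ := i
  match i, hi with
  | 0, _ => exact h

theorem Args.forall_two {S : Type} {X : S → Type u} {s t : S} {x : X s} {y : X t}
    {p : ∀ s, Set (X s)} (hx : x ∈ p s) (hy : y ∈ p t) (i : Fin [s, t].length) :
    Args.two (X := X) x y i ∈ p ([s, t].get i) := by
  obtain ⟨i, hi⟩ := i
  match i, hi with
  | 0, _ => exact hx
  | 1, _ => exact hy

namespace MetricStr.Sub

variable (N : (repStr F hG π hπ).Sub)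

/-- The elements of the group sort of a substructure. -/
def groupSet : Set G := N.car grp

/-- The elements of the sort `Bₙ` of a substructure. -/
def ballSet (n : ℕ) : Set (HBall H n) := N.car (ball n)

variable {N}

theorem mul_mem {g g' : G} (h : g ∈ N.groupSet) (h' : g' ∈ N.groupSet) : g * g' ∈ N.groupSet :=
  N.fn_mem GHFn.mul (Args.two (X := (repStr F hG π hπ).car) (s := grp) (t := grp) g g')
    (Args.forall_two h h')

theorem inv_mem {g : G} (h : g ∈ N.groupSet) : g⁻¹ ∈ N.groupSet :=
  N.fn_mem GHFn.inv (Args.one (X := (repStr F hG π hπ).car) (s := grp) g) (Args.forall_one h)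

theorem one_mem : (1 : G) ∈ N.groupSet :=
  N.fn_mem GHFn.one (Args.zero (X := (repStr F hG π hπ).car)) fun i => i.elim0

theorem zero_mem (n : ℕ) : HBall.zero n ∈ N.ballSet n :=
  N.fn_mem (GHFn.zero n) (Args.zero (X := (repStr F hG π hπ).car)) fun i => i.elim0

theorem incl_mem {m n : ℕ} (hmn : m ≤ n) {x : HBall H m} (h : x ∈ N.ballSet m) :
    HBall.incl hmn x ∈ N.ballSet n :=
  N.fn_mem (GHFn.incl m n hmn) (Args.one (X := (repStr F hG π hπ).car) (s := ball m) x)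
    (Args.forall_one h)

theorem scale_mem (c : ℂ) {m : ℕ} {x : HBall H m} (h : x ∈ N.ballSet m) :
    HBall.scale c x ∈ N.ballSet (scal c * m) :=
  N.fn_mem (GHFn.scale c m) (Args.one (X := (repStr F hG π hπ).car) (s := ball m) x)
    (Args.forall_one h)

theorem add_mem {n : ℕ} {x y : HBall H n} (h : x ∈ N.ballSet n) (h' : y ∈ N.ballSet n) :
    HBall.add x y ∈ N.ballSet (2 * n) :=
  N.fn_mem (GHFn.add n) (Args.two (X := (repStr F hG π hπ).car) (s := ball n) (t := ball n) x y)
    (Args.forall_two h h')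

theorem act_mem {n : ℕ} {g : G} {x : HBall H n} (h : g ∈ N.groupSet) (h' : x ∈ N.ballSet n) :
    HBall.act π g x ∈ N.ballSet n :=
  N.fn_mem (GHFn.act n) (Args.two (X := (repStr F hG π hπ).car) (s := grp) (t := ball n) g x)
    (Args.forall_two h h')

variable (N)

/-- The subgroup of `G` given by a substructure. -/
def subgroup : Subgroup G where
  carrier := N.groupSet
  mul_mem' := mul_mem
  one_mem' := one_mem
  inv_mem' := inv_mem

/-- The subspace of `H` given by a substructure. -/
def subspace : Submodule ℂ H where
  carrier := {v | ∃ (n : ℕ) (x : HBall H n), x ∈ N.ballSet n ∧ x.1 = v}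
  add_mem' := by
    rintro _ _ ⟨m, x, hx, rfl⟩ ⟨n, y, hy, rfl⟩
    exact ⟨_, _, add_mem (incl_mem (m.le_add_right n) hx) (incl_mem (n.le_add_left m) hy), rfl⟩
  zero_mem' := ⟨0, _, zero_mem 0, rfl⟩
  smul_mem' := by
    rintro c _ ⟨m, x, hx, rfl⟩
    exact ⟨_, _, scale_mem c hx, rfl⟩

variable {N}

theorem map_mem_subspace : ∀ g ∈ N.subgroup, ∀ v ∈ N.subspace, π g v ∈ N.subspace := by
  rintro g hg _ ⟨n, x, hx, rfl⟩
  exact ⟨n, _, act_mem hg hx, rfl⟩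

theorem mem_subspace {n : ℕ} {x : HBall H n} (h : x ∈ N.ballSet n) : x.1 ∈ N.subspace :=
  ⟨n, x, h, rfl⟩

/-- The smaller balls of an elementary substructure contain all the vectors of the larger ones
that they may contain. -/
theorem IsElementary.mem_ballSet_of_le (hN : N.IsElementary) {m n : ℕ} (hnm : n ≤ m)
    {x : HBall H m} (hx : x ∈ N.ballSet m) (hxn : ‖x.1‖ ≤ n) :
    (⟨x.1, hxn⟩ : HBall H n) ∈ N.ballSet n := by
  -- The matrix of the axiom `ball_image`, which bounds the distance from a vector to the smaller
  -- ball by the excess of its norm.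
  let θ : CFormula (LGH F) := tsub (bdist (bv m 0) (bincl hnm (bv n 1)))
    (tsub (bnorm (bv m 0)) (const n))
  have hM : ∀ ρ : (repStr F hG π hπ).Asg, (repStr F hG π hπ).val θ ρ =
      max (‖vval ρ (bv m 0) - vval ρ (bv n 1)‖ - max (‖vval ρ (bv m 0)‖ - n) 0) 0 := by
    intro ρ
    simp [θ]
  have hθ : ∀ ρ, N.toStr.val θ ρ ∈ Set.Icc (0 : ℝ) (2 * m) := by
    intro ρ
    rw [hN θ ρ, hM]
    set σ : (repStr F hG π hπ).Asg := fun s k => (ρ s k).1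
    refine ⟨le_max_right _ _, max_le ?_ (by positivity)⟩
    have h1 := norm_vval_le σ (bv m 0)
    have h2 := norm_vval_le σ (bv n 1)
    have h3 : (n : ℝ) ≤ m := by exact_mod_cast hnm
    linarith [norm_sub_le (vval σ (bv m 0)) (vval σ (bv n 1)),
      le_max_right (‖vval σ (bv m 0)‖ - n) 0]
  have h0 : ∀ ρ, N.toStr.val (binf n 1 θ) ρ = 0 :=
    val_eq_zero_of_sup (val_inf_mem hθ _ _) (hN.models (repStr_models_KGH hG π hπ) _
      (Or.inr (Or.inl (HilbertAx.ball_image n m hnm))))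
  -- The axiom only yields approximations within `N`; closedness of the sort turns them into
  -- membership.
  refine (N.closed (ball n)).closure_subset (Metric.mem_closure_iff.2 fun ε hε => ?_)
  let x' : N.toStr.car (ball m) := ⟨x, hx⟩
  let ρ : N.toStr.Asg := N.toStr.upd (fun _ _ => Classical.arbitrary _) (ball m) 0 x'
  have hρ : ρ (ball m) 0 = x' := upd_same _ _ _ _ _
  obtain ⟨y, hy⟩ := exists_val_lt_of_inf_eq_zero (h0 ρ) hε
  rw [hN θ, hM] at hy
  have hv : vval (hG := hG) (π := π) (hπ := hπ)
      (fun s k => (N.toStr.upd ρ (ball n) 1 y s k).1) (bv m 0) = x.1 :=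
    congrArg (fun z : N.toStr.car (ball m) => repStr.toVec z.1)
      ((N.toStr.upd_of_index_ne ρ (ball n) (t := ball m) y zero_ne_one).trans hρ)
  have hw : vval (hG := hG) (π := π) (hπ := hπ)
      (fun s k => (N.toStr.upd ρ (ball n) 1 y s k).1) (bv n 1) = repStr.toVec y.1 :=
    congrArg (fun z : N.toStr.car (ball n) => repStr.toVec z.1)
      (N.toStr.upd_same ρ (ball n) 1 y)
  -- Since `‖x‖ ≤ n` the excess is zero, and `y` is within `ε` of `x`.
  rw [hv, hw, max_eq_right (sub_nonpos.2 hxn), sub_zero] at hy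
  refine ⟨y.1, y.2, ?_⟩
  change dist x.1 (repStr.toVec y.1) < ε
  rw [dist_eq_norm]
  exact (le_max_left _ _).trans_lt hy

/-- A vector of the subspace lies in some ball sort of `N`, possibly of another radius. Inclusions
raise the radius, and `mem_ballSet_of_le` lowers it. -/
theorem IsElementary.mem_ballSet_iff (hN : N.IsElementary) {n : ℕ} (x : HBall H n) :
    x ∈ N.ballSet n ↔ x.1 ∈ N.subspace := by
  refine ⟨mem_subspace, ?_⟩
  rintro ⟨m, y, hy, hyx⟩
  rcases le_total m n with h | h
  · have : HBall.incl h y = x := Subtype.ext hyx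
    exact this ▸ incl_mem h hy
  · have := hN.mem_ballSet_of_le h hy (hyx ▸ x.2)
    have hx : (⟨y.1, hyx ▸ x.2⟩ : HBall H n) = x := Subtype.ext hyx
    exact hx ▸ this

theorem IsElementary.isClosed_subspace (hN : N.IsElementary) :
    IsClosed (N.subspace : Set H) := by
  refine isClosed_of_closure_subset fun v hv => ?_
  -- The extra `1` keeps all points within distance `1` of `v` in the ball of radius `n`, where the
  -- sort of `N` is closed.
  obtain ⟨n, hn⟩ := exists_nat_ge (‖v‖ + 1)
  have hvn : ‖v‖ ≤ n := by linarith
  refine (hN.mem_ballSet_iff ⟨v, hvn⟩).1 ?_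
  refine (N.closed (ball n)).closure_subset (Metric.mem_closure_iff.2 fun ε hε => ?_)
  obtain ⟨w, hw, hvw⟩ := Metric.mem_closure_iff.1 hv (min ε 1) (by positivity)
  rw [lt_min_iff] at hvw
  have hwn : ‖w‖ ≤ n := by
    have := norm_sub_norm_le w v
    rw [← dist_eq_norm, dist_comm] at this
    linarith
  exact ⟨(⟨w, hwn⟩ : HBall H n), (hN.mem_ballSet_iff ⟨w, hwn⟩).2 hw, hvw.1⟩

theorem isMetricGroup_subgroup : IsMetricGroup N.subgroup where
  complete := (N.closed grp).completeSpace_coe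
  dist_le_one x y := hG.dist_le_one x y
  left_inv g x y := hG.left_inv g x y
  right_inv g x y := hG.right_inv g x y

end MetricStr.Sub

namespace MetricStr.Sub.IsElementary

variable {N : (repStr F hG π hπ).Sub} (hN : N.IsElementary)

/-- The sorts of an elementary substructure are those of the representation of its subgroup on its
subspace. -/
def carEquiv : ∀ s : GHSort, N.toStr.car s ≃ GHCar N.subgroup N.subspace s
  | .grp => Equiv.refl N.groupSet
  | .ball n =>
    { toFun := fun x => ⟨⟨(x.1 : HBall H n).1, mem_subspace x.2⟩, (x.1 : HBall H n).2⟩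
      invFun := fun y => ⟨(⟨y.1.1, y.2⟩ : HBall H n), (hN.mem_ballSet_iff ⟨y.1.1, y.2⟩).2 y.1.2⟩
      left_inv := fun _ => rfl
      right_inv := fun _ => rfl }

/-- An elementary substructure is the structure of the representation of its subgroup on its
subspace. -/
def iso [CompleteSpace N.subspace] :
    N.toStr.Iso (repStr F N.isMetricGroup_subgroup
      (subRep π N.subgroup N.subspace map_mem_subspace)
      (hπ.subRep N.subgroup N.subspace map_mem_subspace)) where
  map := hN.carEquiv
  map_dist s x y := by cases s <;> rfl
  map_fn f a := by cases f <;> rfl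
  map_rel R a := by cases R <;> rfl

/-- Each formula about groups is translated, compared in `N` and `A(G, H)` by elementarity, and
translated back. -/
theorem exists_grpStr_sub (hN : N.IsElementary) :
    ∃ S : (grpStr G hG).Sub, S.car () = (N.subgroup : Set G) ∧ S.IsElementary := by
  let S : (grpStr G hG).Sub :=
    { car := fun _ => N.groupSet
      closed := fun _ => N.closed grp
      nonempty := fun _ => N.nonempty grp
      fn_mem := by
        rintro l s (_ | _ | _) a ha
        · exact mul_mem (N := N) (ha ⟨0, by simp⟩) (ha ⟨1, by simp⟩)
        · exact inv_mem (N := N) (ha ⟨0, by simp⟩)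
        · exact one_mem (N := N) }
  let eS : IsGrpReduct S.toStr N.toStr :=
    { map := Equiv.refl N.groupSet
      map_dist := fun _ _ => rfl
      map_mul := fun _ => rfl
      map_inv := fun _ => rfl
      map_one := fun _ => rfl }
  let eG : IsGrpReduct (grpStr G hG) (repStr F hG π hπ) :=
    { map := Equiv.refl G
      map_dist := fun _ _ => rfl
      map_mul := fun _ => rfl
      map_inv := fun _ => rfl
      map_one := fun _ => rfl }
  refine ⟨S, rfl, fun φ ρ => ?_⟩
  let σ : N.toStr.Asg := fun s => match s with
    | .grp => ρ ()
    | .ball n => fun _ => Classical.arbitrary (N.toStr.car (ball n))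
  rw [← eS.val_ofGrp φ (ρ := ρ) (σ := σ) (fun _ => rfl), hN]
  exact eG.val_ofGrp φ fun _ => rfl

theorem exists_hilbStr_sub (hN : N.IsElementary) :
    ∃ S : (hilbStr H).Sub, (∀ n : ℕ, S.car n = {x : HBall H n | x.1 ∈ N.subspace}) ∧
      S.IsElementary := by
  let S : (hilbStr H).Sub :=
    { car := fun n => N.ballSet n
      closed := fun n => N.closed (ball n)
      nonempty := fun n => N.nonempty (ball n)
      fn_mem := by
        rintro l s (n | ⟨m, n, hmn⟩ | ⟨c, m⟩ | n | n) a ha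
        · exact zero_mem (N := N) _
        · exact incl_mem (N := N) hmn (ha ⟨0, by simp⟩)
        · exact scale_mem (N := N) c (ha ⟨0, by simp⟩)
        · exact add_mem (N := N) (ha ⟨0, by simp⟩) (ha ⟨1, by simp⟩)
        · exact N.fn_mem (GHFn.sub n) (Args.two (X := (repStr F hG π hπ).car) (s := ball n)
            (t := ball n) a.fst a.snd) (Args.forall_two (ha ⟨0, by simp⟩) (ha ⟨1, by simp⟩)) }
  let eS : IsHilbReduct S.toStr N.toStr :=
    { map := fun n => Equiv.refl (N.ballSet n)
      map_dist := fun _ _ _ => rfl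
      map_zero := fun _ _ => rfl
      map_incl := fun _ _ _ _ => rfl
      map_scale := fun _ _ _ => rfl
      map_add := fun _ _ => rfl
      map_sub := fun _ _ => rfl
      map_re := fun _ _ => rfl
      map_im := fun _ _ => rfl }
  let eH : IsHilbReduct (hilbStr H) (repStr F hG π hπ) :=
    { map := fun n => Equiv.refl (HBall H n)
      map_dist := fun _ _ _ => rfl
      map_zero := fun _ _ => rfl
      map_incl := fun _ _ _ _ => rfl
      map_scale := fun _ _ _ => rfl
      map_add := fun _ _ => rfl
      map_sub := fun _ _ => rfl
      map_re := fun _ _ => rfl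
      map_im := fun _ _ => rfl }
  refine ⟨S, fun n => Set.ext hN.mem_ballSet_iff, fun φ ρ => ?_⟩
  let σ : N.toStr.Asg := fun s => match s with
    | .grp => fun _ => Classical.arbitrary (N.toStr.car grp)
    | .ball n => ρ n
  rw [← eS.val_ofHilb φ (ρ := ρ) (σ := σ) (fun _ _ => rfl), hN]
  exact eH.val_ofHilb φ fun _ _ => rfl

end MetricStr.Sub.IsElementary

end ElementarySub

end

theorem theorem2p2 (F : ℕ → ℝ → ℝ) (hF : ∀ (n : ℕ) (ε : ℝ), 0 < ε → 0 < F n ε) :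
    -- (a)
    (∀ (G : Type u) [Group G] [MetricSpace G] [LocallyCompactSpace G] (hG : IsMetricGroup G)
        (H : Type u) [NormedAddCommGroup H] [InnerProductSpace ℂ H] [CompleteSpace H]
        (π : G →* (H ≃ₗᵢ[ℂ] H)) (hπ : FContinuous F π),
        AlmostContainsUnit π ↔
          ∃ δ : ℚ, 0 < δ ∧ δ < 1 ∧ (repStr F hG π hπ).Models (GHTheory.Kdelta F δ)) ∧
    -- (b)
    (∀ (G : Type u) [Group G] [MetricSpace G] [LocallyCompactSpace G] (hG : IsMetricGroup G),
        (∀ Q : Set G, IsCompact Q → ∀ ε : ℝ, 0 < ε →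
          ∃ (H : Type u) (_ : NormedAddCommGroup H) (_ : InnerProductSpace ℂ H)
            (_ : CompleteSpace H) (π : G →* (H ≃ₗᵢ[ℂ] H)),
            FContinuous F π ∧ HasAlmostInvariant π Q ε ∧
              ¬ ∃ v : H, v ≠ 0 ∧ ∀ g : G, π g v = v) →
        ∃ (H : Type u) (_ : NormedAddCommGroup H) (_ : InnerProductSpace ℂ H)
          (_ : CompleteSpace H) (π : G →* (H ≃ₗᵢ[ℂ] H)) (hπ : FContinuous F π),
          ¬ FiniteDimensional ℂ H ∧
          (repStr F hG π hπ).Models (GHTheory.KGH F) ∧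
          AlmostContainsUnit π ∧
          (¬ ∃ v : H, ‖v‖ = 1 ∧ ∀ g : G, π g v = v) ∧
          -- every elementary substructure is some `A(G₀, H₀)`
          ∀ N : (repStr F hG π hπ).Sub, N.IsElementary →
            ∃ (G₀ : Subgroup G) (H₀ : Submodule ℂ H)
              (hinv : ∀ g ∈ G₀, ∀ v ∈ H₀, π g v ∈ H₀)
              (hG₀ : IsMetricGroup G₀) (_ : CompleteSpace H₀)
              (hπ₀ : FContinuous F (subRep π G₀ H₀ hinv)),
              -- `N` is `A(G₀, H₀)`, with the inclusions of `G₀` in `G` and of `H₀` in `H`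
              (∃ e : N.toStr.Iso (repStr F hG₀ (subRep π G₀ H₀ hinv) hπ₀),
                (∀ g : N.car GHSort.grp,
                  ((repStr.toGroup (e.map GHSort.grp g) : G₀) : G) = repStr.toGroup g.1) ∧
                (∀ (n : ℕ) (x : N.car (GHSort.ball n)),
                  ((repStr.toVec (e.map (GHSort.ball n) x) : H₀) : H) = repStr.toVec x.1)) ∧
              -- `G₀ ≼ G` as metric groups
              (∃ S : (grpStr G hG).Sub, S.car () = (G₀ : Set G) ∧ S.IsElementary) ∧
              -- `H₀ ≼ H` as Hilbert spaces
              (∃ S : (hilbStr H).Sub, (∀ n : ℕ, S.car n = {x : HBall H n | x.1 ∈ H₀}) ∧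
                S.IsElementary) ∧
              AlmostContainsUnit (subRep π G₀ H₀ hinv) ∧
              ¬ ∃ v : H₀, ‖v‖ = 1 ∧ ∀ g : G₀, subRep π G₀ H₀ hinv g v = v) := by
  refine ⟨fun G _ _ _ hG H _ _ _ π hπ => ⟨fun h => ?_, ?_⟩, fun G _ _ _ hG h => ?_⟩
  · obtain ⟨δ, hδ0, hδ1, hδ⟩ := hG.exists_isCompact_closedBall
    exact ⟨δ, hδ0, hδ1,
      GHTheory.models_Kdelta_of_almostContainsUnit (by exact_mod_cast hδ0) hδ h⟩
  · rintro ⟨δ, hδ0, -, hδ⟩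
    exact GHTheory.almostContainsUnit_of_models_Kdelta (by exact_mod_cast hδ0) hδ
  · obtain ⟨H, _, _, _, π, hπ, hac, hinv⟩ := exists_almostContainsUnit_no_invariant h
    have hunit : ¬ ∃ v : H, ‖v‖ = 1 ∧ ∀ g : G, π g v = v := fun ⟨v, hv, hvg⟩ =>
      hinv ⟨v, norm_ne_zero_iff.1 (by simp [hv]), hvg⟩
    refine ⟨H, inferInstance, inferInstance, inferInstance, π, hπ,
      fun _ => hunit hac.exists_invariant, GHTheory.repStr_models_KGH hG π hπ, hac, hunit,
      fun N hN => ?_⟩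
    have : CompleteSpace N.subspace := hN.isClosed_subspace.completeSpace_coe
    obtain ⟨δ, hδ0, -, hδ⟩ := hG.exists_isCompact_closedBall
    have hδ' : (0 : ℝ) < δ := by exact_mod_cast hδ0
    refine ⟨N.subgroup, N.subspace, MetricStr.Sub.map_mem_subspace, N.isMetricGroup_subgroup, this,
      hπ.subRep _ _ _, ⟨hN.iso, fun _ => rfl, fun _ _ => rfl⟩, hN.exists_grpStr_sub,
      hN.exists_hilbStr_sub, ?_, ?_⟩
    -- The axioms of `K_δ` pass from `A(G, H)` to `N` and along the isomorphism to `A(G₀, H₀)`,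
    -- where they give back almost containment.
    · exact GHTheory.almostContainsUnit_of_models_Kdelta hδ' (hN.iso.models
        (hN.models (GHTheory.models_Kdelta_of_almostContainsUnit (hπ := hπ) hδ' hδ hac)))
    · exact GHTheory.no_invariant_of_val_displacement (hN.iso.models (hN.models
        (T := {GHTheory.displacement F})
        (fun _ hφ => hφ ▸ GHTheory.val_displacement_of_no_invariant hinv)) _ rfl)
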